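/- For a probability measure $\mu$ on a countable group $G$, the random walk $(G,\mu)$ with initial distribution $\theta$ has sample paths $(g_t)_{t\ge 0}\in G^{\mathbb Z_+}$, $g_t=g_0h_1h_2\cdots h_t$, where $g_0$ is $\theta$-distributed and the increments $h_1,h_2,\dots$ are $\mu$-distributed, independent of each other and of $g_0$; denote by $\mathbf P_\theta$ the resulting measure on $G^{\mathbb Z_+}$ (the initial distribution $\theta$ need not be a probability measure). Let $\#$ be the counting measure on $G$, and let $T(g_0,g_1,g_2,\dots)=(g_1,g_2,g_3,\dots)$ be the time shift. The exit $\sigma$-algebra of $(G,\mu)$ is the completion with respect to $\mathbf P_{\#}$ of the $\sigma$-algebra of $T$-invariant measurable subsets of $G^{\mathbb Z_+}$, the Poisson boundary is the quotient of the path space $(G^{\mathbb Z_+},\mathbf P_{\#})$ determined by this $\sigma$-algebra, and the primary harmonic measure $\nu$ is the image on the Poisson boundary of the measure $\mathbf P=\mathbf P_{\delta_e}$ corresponding to the random walk issued from the group identity $e$. The measure $\mu$ is called Liouville if $\nu$ is a delta measure, i.e., if $\mathbf P(A)\in\{0,1\}$ for every set $A$ from the exit $\sigma$-algebra. The entropy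 of $\mu$ is $H(\mu)=-\sum_{g\in G}\mu(g)\log\mu(g)\in[0,\infty]$ (with $0\log 0=0$). Let $G$ and $G'$ be countable groups, and let $\widetilde\mu$ be a probability measure on the product group $G\times G'$ with finite entropy $H(\widetilde\mu)<\infty$. Let $\mu$ and $\mu'$ be the marginal distributions of $\widetilde\mu$, i.e., its images under the coordinate projections onto $G$ and $G'$, respectively. Then $\widetilde\mu$ is Liouville if and only if both $\mu$ and $\mu'$ are Liouville. -/

import Mathlib

open MeasureTheory

noncomputable section

namespace RandomWalk

/-- The sample path `g₀ = g`, `g_{t+1} = g_t * h_t` with starting point `g` and increments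
`h 0, h 1, …`, i.e. `g_t = g * h 0 * ⋯ * h (t - 1)`. -/
def path {G : Type*} [Group G] (g : G) (h : ℕ → G) : ℕ → G
  | 0 => g
  | t + 1 => path g h t * h t

/-- The sample path depends measurably on the starting point and the increments. -/
theorem measurable_path {G : Type*} [Group G] [Countable G] [MeasurableSpace G]
    [DiscreteMeasurableSpace G] :
    Measurable (fun p : G × (ℕ → G) => path p.1 p.2) := by
  refine measurable_pi_iff.mpr fun t => ?_
  induction t with
  | zero => exact measurable_fst
  | succ t ih =>
    have h2 : Measurable (fun p : G × (ℕ → G) => p.2 t) :=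
      (measurable_pi_apply t).comp measurable_snd
    exact (Measurable.of_discrete (f := fun q : G × G => q.1 * q.2)).comp (ih.prodMk h2)

/-- The Markov measure on the space `ℕ → G` of sample paths of the random walk `(G, μ)` with
initial distribution `θ` (not necessarily a probability measure): the starting point has
distribution `θ`, and the increments are independent, `μ`-distributed and independent of it. -/
def markovMeasure {G : Type*} [Group G] [MeasurableSpace G] (μ θ : Measure G) :
    Measure (ℕ → G) :=
  (θ.prod (Measure.infinitePi fun _ : ℕ => μ)).map fun p => path p.1 p.2

/-- The time shift `(g₀, g₁, g₂, …) ↦ (g₁, g₂, g₃, …)` on the space of sample paths. -/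
def shift {G : Type*} (x : ℕ → G) : ℕ → G := fun t => x (t + 1)

/-- The exit σ-algebra of the random walk `(G, μ)`: the completion of the σ-algebra of
shift-invariant measurable sets of sample paths with respect to the σ-finite Markov measure whose
initial distribution is the counting measure on `G`. -/
@[reducible]
def exitSigmaAlgebra {G : Type*} [Group G] [MeasurableSpace G] (μ : Measure G) :
    MeasurableSpace (ℕ → G) :=
  eventuallyMeasurableSpace (MeasurableSpace.invariants (shift (G := G)))
    (ae (markovMeasure μ Measure.count))

/-- `μ` is Liouville: the primary harmonic measure, i.e. the image on the Poisson boundary (the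
quotient of the path space determined by the exit σ-algebra) of the Markov measure issued from the
group identity, is a delta measure. In terms of the path space, every set of the exit σ-algebra
has probability `0` or `1` for the random walk issued from the identity. -/
def IsLiouville {G : Type*} [Group G] [MeasurableSpace G] (μ : Measure G) : Prop :=
  ∀ A : Set (ℕ → G), MeasurableSet[exitSigmaAlgebra μ] A →
    markovMeasure μ (Measure.dirac 1) A = 0 ∨ markovMeasure μ (Measure.dirac 1) A = 1

/-- The entropy `H(μ) = - ∑ μ(g) log μ(g)` of a probability measure on a countable group, as an
element of `[0, ∞]`. -/
def entropy {G : Type*} [MeasurableSpace G] (μ : Measure G) : ENNReal :=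
  ∑' g : G, ENNReal.ofReal (Real.negMulLog (μ.real {g}))

end RandomWalk

end

/-!
A probability measure `μ` is Liouville if and only if every bounded `μ`-harmonic function `f`
satisfies `f a = f 1` for all `a` in the support of `μ` (`LiouvilleProperty`). In one direction the
probability that the path issued from `g` falls in an invariant event is a bounded harmonic function
of `g`; if it is constant along the steps of the walk, then the event is independent of every
cylinder, hence of itself (`LiouvilleProperty.isLiouville`). In the other direction `f` along the
walk is a bounded martingale whose limit is an invariant function, hence constant
(`IsLiouville.liouvilleProperty`).

Liouville measures are stable under homomorphisms, as invariant events pull back to invariant events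
(`IsLiouville.map`). This settles one implication.

For the converse, both the harmonic functions of `μ` and the marginals behave well under replacing
`μ` by the lazy measure `p = (δ₁ + μ) / 2`, which again has finite entropy. Let `Hₙ` be the entropy
of the convolution power `pⁿ`. The increment `Hₙ₊₁ - Hₙ` is the average over a `p`-random `a` of
the relative entropy of the translate `a pⁿ` with respect to the mixture `pⁿ⁺¹` of such translates
(`hasSum_mul_translateDiv`).

* If `p` has the Liouville property, then `‖a pⁿ - pⁿ⁺¹‖₁ → 0` for every `a` in the support
  (`tendsto_translationGap`): otherwise, with `P` the Markov operator and `|fₙ| ≤ 1` testing the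
  distance, a pointwise limit of the functions `Pⁿ fₙ` is bounded and separates `a` from `1`; it is
  harmonic because laziness forces `‖Pⁿ⁺¹ - Pⁿ‖ → 0`. The relative entropies are controlled by these
  distances and dominated by `- log p(a)`, so `Hₙ₊₁ - Hₙ → 0` (`tendsto_shannon_convPow_diff`).
* If the increments `Hₙ₊₁ - Hₙ` are not bounded away from `0`, then a Pinsker type inequality makes
  `‖a pⁿ - pⁿ⁺¹‖₁` arbitrarily small, which forces `f a = f 1` for bounded harmonic `f`
  (`LiouvilleProperty.of_shannon_diff`).

For a measure on a product the entropy of the `n`-th power is at most the sum of the entropies of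
the `n`-th powers of the marginals. If both of these have increments tending to `0`, they grow
sublinearly, so the increments of the former cannot stay above a positive constant
(`LiouvilleProperty.prod`).
-/

noncomputable section

namespace RandomWalk

open Filter Topology

section Series

open Real

variable {α β G H : Type*}

/-! ### Probability vectors, entropy and convolution powers -/

/-- `p` is a probability vector: a nonnegative function on `α` (of any cardinality) with
unconditional sum `1`. -/
structure IsProb (p : α → ℝ) : Prop where
  nonneg : ∀ x, 0 ≤ p x
  hasSum : HasSum p 1

theorem IsProb.le_one {p : α → ℝ} (hp : IsProb p) (x : α) : p x ≤ 1 :=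
  le_hasSum hp.hasSum x fun y _ => hp.nonneg y

theorem hasSum_prod_of_nonneg {f : α × β → ℝ} {g : α → ℝ} {s : ℝ} (hf : ∀ z, 0 ≤ f z)
    (h1 : ∀ a, HasSum (fun b => f (a, b)) (g a)) (h2 : HasSum g s) : HasSum f s := by
  have hs : Summable f := by
    rw [summable_prod_of_nonneg hf]
    refine ⟨fun a => (h1 a).summable, ?_⟩
    simpa only [(h1 _).tsum_eq] using h2.summable
  have := hs.hasSum.prod_fiberwise h1
  rw [← this.unique h2]
  exact hs.hasSum

theorem hasSum_mul_prod {f : α → ℝ} {g : β → ℝ} {s t : ℝ} (hf0 : ∀ a, 0 ≤ f a)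
    (hg0 : ∀ b, 0 ≤ g b) (hf : HasSum f s) (hg : HasSum g t) :
    HasSum (fun z : α × β => f z.1 * g z.2) (s * t) :=
  hasSum_prod_of_nonneg (fun _ => mul_nonneg (hf0 _) (hg0 _)) (fun a => hg.mul_left (f a))
    (hf.mul_right t)

theorem IsProb.prod {p : α → ℝ} {q : β → ℝ} (hp : IsProb p) (hq : IsProb q) :
    IsProb fun z : α × β => p z.1 * q z.2 where
  nonneg _ := mul_nonneg (hp.nonneg _) (hq.nonneg _)
  hasSum := by simpa using hasSum_mul_prod hp.nonneg hq.nonneg hp.hasSum hq.hasSum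

theorem IsProb.comp_equiv {p : α → ℝ} (hp : IsProb p) (e : β ≃ α) : IsProb (p ∘ e) where
  nonneg _ := hp.nonneg _
  hasSum := e.hasSum_iff.mpr hp.hasSum

/-- The first marginal of a function `m` on a product, `a ↦ ∑ b, m (a, b)`. -/
def marginalFst (m : α × β → ℝ) (a : α) : ℝ := ∑' b, m (a, b)

/-- The second marginal of a function `m` on a product, `b ↦ ∑ a, m (a, b)`. -/
def marginalSnd (m : α × β → ℝ) (b : β) : ℝ := ∑' a, m (a, b)

theorem marginalFst_swap (m : α × β → ℝ) : marginalFst (m ∘ Prod.swap) = marginalSnd m := rfl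

theorem IsProb.hasSum_fst {m : α × β → ℝ} (hm : IsProb m) (a : α) :
    HasSum (fun b => m (a, b)) (marginalFst m a) :=
  (hm.hasSum.summable.prod_factor a).hasSum

theorem IsProb.marginalFst {m : α × β → ℝ} (hm : IsProb m) : IsProb (marginalFst m) where
  nonneg _ := tsum_nonneg fun _ => hm.nonneg _
  hasSum := hm.hasSum.prod_fiberwise hm.hasSum_fst

theorem IsProb.swap {m : α × β → ℝ} (hm : IsProb m) : IsProb (m ∘ Prod.swap) :=
  hm.comp_equiv (Equiv.prodComm β α)

theorem IsProb.marginalSnd {m : α × β → ℝ} (hm : IsProb m) : IsProb (marginalSnd m) :=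
  hm.swap.marginalFst

theorem IsProb.hasSum_snd {m : α × β → ℝ} (hm : IsProb m) (b : β) :
    HasSum (fun a => m (a, b)) (RandomWalk.marginalSnd m b) :=
  hm.swap.hasSum_fst b

/-- The Shannon entropy of `p` as a real number. It is the junk value `0` when the entropy is
infinite, so finiteness is always assumed separately as summability of `negMulLog ∘ p`. -/
def shannon (p : α → ℝ) : ℝ := ∑' x, negMulLog (p x)

theorem IsProb.negMulLog_nonneg {p : α → ℝ} (hp : IsProb p) (x : α) : 0 ≤ negMulLog (p x) :=
  Real.negMulLog_nonneg (hp.nonneg x) (hp.le_one x)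

theorem IsProb.shannon_nonneg {p : α → ℝ} (hp : IsProb p) : 0 ≤ shannon p :=
  tsum_nonneg hp.negMulLog_nonneg

/-- Countable subadditivity of `negMulLog`; hence passing to a marginal does not increase entropy. -/
theorem negMulLog_le_tsum {x : α → ℝ} {s : ℝ} (hx : ∀ i, 0 ≤ x i) (hs : HasSum x s)
    (h : Summable fun i => negMulLog (x i)) : negMulLog s ≤ ∑' i, negMulLog (x i) := by
  -- Write `negMulLog s = ∑ x i * (-log s)` and use `x i ≤ s` in each term.
  have h1 : HasSum (fun i => x i * (-log s)) (s * (-log s)) := hs.mul_right _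
  have h2 : negMulLog s = s * (-log s) := by simp [negMulLog]
  rw [h2, ← h1.tsum_eq]
  refine h1.summable.tsum_le_tsum (fun i => ?_) h
  rcases (hx i).eq_or_lt with h0 | h0
  · simp [← h0]
  · have : log (x i) ≤ log s := log_le_log h0 (le_hasSum hs i fun j _ => hx j)
    rw [negMulLog]
    nlinarith

theorem IsProb.summable_negMulLog_prod {p : α → ℝ} {q : β → ℝ} (hp : IsProb p) (hq : IsProb q)
    (hp' : Summable fun x => negMulLog (p x)) (hq' : Summable fun x => negMulLog (q x)) :
    Summable fun z : α × β => negMulLog (p z.1 * q z.2) := by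
  have h1 := hasSum_mul_prod hp.negMulLog_nonneg hq.nonneg hp'.hasSum hq.hasSum
  have h2 := hasSum_mul_prod hp.nonneg hq.negMulLog_nonneg hp.hasSum hq'.hasSum
  refine (h1.add h2).summable.congr fun z => ?_
  rw [negMulLog_mul]; ring

theorem IsProb.summable_negMulLog_fst {m : α × β → ℝ} (hm : IsProb m)
    (h : Summable fun z => negMulLog (m z)) :
    Summable fun a => negMulLog (RandomWalk.marginalFst m a) := by
  refine Summable.of_nonneg_of_le hm.marginalFst.negMulLog_nonneg (fun a => ?_) h.prod
  exact negMulLog_le_tsum (fun b => hm.nonneg _) (hm.hasSum_fst a) (h.prod_factor a)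

theorem summable_swap {f : α × β → ℝ} (h : Summable f) : Summable (f ∘ Prod.swap) :=
  (Equiv.prodComm β α).summable_iff.mpr h

theorem IsProb.summable_negMulLog_snd {m : α × β → ℝ} (hm : IsProb m)
    (h : Summable fun z => negMulLog (m z)) :
    Summable fun b => negMulLog (RandomWalk.marginalSnd m b) :=
  hm.swap.summable_negMulLog_fst (summable_swap h)

/-- Subadditivity of entropy: the entropy of a joint distribution is at most the sum of the
entropies of its marginals (Gibbs' inequality against the product of the marginals). -/
theorem IsProb.shannon_le_add {m : α × β → ℝ} (hm : IsProb m)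
    (h : Summable fun z => negMulLog (m z)) :
    shannon m ≤ shannon (RandomWalk.marginalFst m) + shannon (RandomWalk.marginalSnd m) := by
  set r := RandomWalk.marginalFst m with hr
  set s := RandomWalk.marginalSnd m with hs
  have hr' : IsProb r := hm.marginalFst
  have hs' : IsProb s := hm.marginalSnd
  have h1 : HasSum (fun z : α × β => m z * (-log (r z.1))) (shannon r) := by
    refine hasSum_prod_of_nonneg (fun z => mul_nonneg (hm.nonneg _) ?_) (fun a => ?_)
      (hm.summable_negMulLog_fst h).hasSum
    · exact neg_nonneg.mpr (log_nonpos (hr'.nonneg _) (hr'.le_one _))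
    · have := (hm.hasSum_fst a).mul_right (-log (r a))
      rw [mul_neg, ← neg_mul] at this
      exact this
  have h2 : HasSum (fun z : α × β => m z * (-log (s z.2))) (shannon s) := by
    rw [← (Equiv.prodComm β α).hasSum_iff]
    refine hasSum_prod_of_nonneg (fun z => mul_nonneg (hm.nonneg _) ?_) (fun a => ?_)
      (hm.summable_negMulLog_snd h).hasSum
    · exact neg_nonneg.mpr (log_nonpos (hs'.nonneg _) (hs'.le_one _))
    · have := (hm.hasSum_snd a).mul_right (-log (s a))
      rw [mul_neg, ← neg_mul] at this
      exact this
  have h3 := ((h1.add h2).add (hr'.prod hs').hasSum).sub hm.hasSum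
  rw [add_sub_cancel_right] at h3
  refine hasSum_le (fun z => ?_) h.hasSum h3
  rcases (hm.nonneg z).eq_or_lt with h0 | h0
  · simp only [← h0, negMulLog_zero, zero_mul]
    have := mul_nonneg (hr'.nonneg z.1) (hs'.nonneg z.2)
    linarith
  · have hrz : 0 < r z.1 := h0.trans_le (le_hasSum (hm.hasSum_fst z.1) z.2 fun j _ => hm.nonneg _)
    have hsz : 0 < s z.2 := h0.trans_le (le_hasSum (hm.hasSum_snd z.2) z.1 fun j _ => hm.nonneg _)
    have hk := Real.log_le_sub_one_of_pos (div_pos (mul_pos hrz hsz) h0)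
    rw [log_div (mul_pos hrz hsz).ne' h0.ne', log_mul hrz.ne' hsz.ne'] at hk
    have := mul_le_mul_of_nonneg_left hk h0.le
    rw [mul_sub (m z) (_ / _), mul_div_cancel₀ _ h0.ne'] at this
    rw [negMulLog]
    nlinarith

section Group

variable [Group G] [Group H]

/-- The shear `(a, y) ↦ (a, a⁻¹ * y)`. Pulling the vector `p ⊗ q` back along it gives the joint
distribution of `(a, a * b)` for independent `a` and `b` with distributions `p` and `q`. -/
def shear (G : Type*) [Group G] : G × G ≃ G × G :=
  Equiv.prodShear (Equiv.refl G) fun a => Equiv.mulLeft a⁻¹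

@[simp] theorem shear_apply (z : G × G) : shear G z = (z.1, z.1⁻¹ * z.2) := rfl

/-- The convolution of `p` and `q`: the distribution of `a * b` for independent `a` and `b` with
distributions `p` and `q`. -/
def conv (p q : G → ℝ) (y : G) : ℝ := ∑' a, p a * q (a⁻¹ * y)

theorem IsProb.shear {p q : G → ℝ} (hp : IsProb p) (hq : IsProb q) :
    IsProb fun z : G × G => p z.1 * q (z.1⁻¹ * z.2) :=
  (hp.prod hq).comp_equiv (RandomWalk.shear G)

theorem IsProb.conv {p q : G → ℝ} (hp : IsProb p) (hq : IsProb q) : IsProb (conv p q) :=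
  (hp.shear hq).marginalSnd

theorem IsProb.hasSum_conv {p q : G → ℝ} (hp : IsProb p) (hq : IsProb q) (y : G) :
    HasSum (fun a => p a * q (a⁻¹ * y)) (RandomWalk.conv p q y) :=
  (hp.shear hq).hasSum_snd y

theorem IsProb.summable_negMulLog_conv {p q : G → ℝ} (hp : IsProb p) (hq : IsProb q)
    (hp' : Summable fun x => negMulLog (p x)) (hq' : Summable fun x => negMulLog (q x)) :
    Summable fun y => negMulLog (RandomWalk.conv p q y) :=
  (hp.shear hq).summable_negMulLog_snd
    ((RandomWalk.shear G).summable_iff.mpr (hp.summable_negMulLog_prod hq hp' hq'))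

theorem marginalFst_conv {p q : G × H → ℝ} (hp : IsProb p) (hq : IsProb q) :
    marginalFst (conv p q) = conv (marginalFst p) (marginalFst q) := by
  funext y
  have h1 : ∀ b : H, HasSum (fun z : G × H => p z * q (z⁻¹ * (y, b))) (conv p q (y, b)) :=
    fun b => hp.hasSum_conv hq (y, b)
  have hs : Summable fun w : H × (G × H) => p w.2 * q (w.2⁻¹ * (y, w.1)) := by
    have := (hp.shear hq).swap.hasSum.summable
    exact this.comp_injective (i := fun w : H × (G × H) => ((y, w.1), w.2))
      (fun w w' h => by simp only [Prod.mk.injEq, true_and] at h; exact Prod.ext h.1 h.2)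
  have h2 : ∀ z : G × H, HasSum (fun b : H => p z * q (z⁻¹ * (y, b)))
      (p z * marginalFst q (z.1⁻¹ * y)) := by
    intro z
    refine HasSum.mul_left (p z) ?_
    exact (Equiv.mulLeft z.2⁻¹).hasSum_iff.mpr (hq.hasSum_fst (z.1⁻¹ * y))
  have h3 : marginalFst (conv p q) y = ∑' z : G × H, p z * marginalFst q (z.1⁻¹ * y) := by
    rw [marginalFst]
    simp_rw [← (h1 _).tsum_eq, ← (h2 _).tsum_eq]
    exact Summable.tsum_comm (f := fun (z : G × H) (b : H) => p z * q (z⁻¹ * (y, b)))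
      (summable_swap hs)
  have hs' : Summable fun z : G × H => p z * marginalFst q (z.1⁻¹ * y) := by
    refine Summable.of_nonneg_of_le
      (fun z => mul_nonneg (hp.nonneg _) (hq.marginalFst.nonneg _)) (fun z => ?_)
      hp.hasSum.summable
    exact mul_le_of_le_one_right (hp.nonneg _) (hq.marginalFst.le_one _)
  rw [h3, hs'.tsum_prod]
  refine tsum_congr fun a => ?_
  exact tsum_mul_right (f := fun c => p (a, c)) (a := marginalFst q (a⁻¹ * y))

theorem conv_swap (p q : G × H → ℝ) :
    conv p q ∘ Prod.swap = conv (p ∘ Prod.swap) (q ∘ Prod.swap) := by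
  funext y
  exact ((Equiv.prodComm H G).tsum_eq fun z => p z * q (z⁻¹ * y.swap)).symm

theorem marginalSnd_conv {p q : G × H → ℝ} (hp : IsProb p) (hq : IsProb q) :
    marginalSnd (conv p q) = conv (marginalSnd p) (marginalSnd q) := by
  rw [← marginalFst_swap, conv_swap, marginalFst_conv hp.swap hq.swap]
  rfl

open Classical in
/-- The point mass at the identity. -/
def unitMass (G : Type*) [Group G] : G → ℝ := Pi.single 1 1

theorem hasSum_unitMass_mul (f : G → ℝ) : HasSum (fun a => unitMass G a * f a) (f 1) := by
  classical
  convert! hasSum_single (f := fun a => unitMass G a * f a) 1 (fun b hb => ?_) using 1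
  · simp [unitMass]
  · simp [unitMass, hb]

theorem isProb_unitMass : IsProb (unitMass G) where
  nonneg x := by
    classical
    by_cases h : x = 1 <;> simp [unitMass, h]
  hasSum := by simpa using hasSum_unitMass_mul (G := G) fun _ => 1

theorem summable_negMulLog_unitMass : Summable fun x => negMulLog (unitMass G x) := by
  classical
  refine (summable_zero).congr fun x => ?_
  by_cases h : x = 1 <;> simp [unitMass, h]

theorem marginalFst_unitMass : marginalFst (unitMass (G × H)) = unitMass G := by
  classical
  funext a
  rw [marginalFst]
  by_cases ha : a = 1
  · subst ha
    rw [tsum_eq_single 1]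
    · simp [unitMass, ← Prod.one_eq_mk]
    · intro b hb; simp [unitMass, Prod.ext_iff, hb]
  · simp [unitMass, Prod.ext_iff, ha]

theorem unitMass_swap : unitMass (G × H) ∘ Prod.swap = unitMass (H × G) := by
  classical
  funext a
  simp [unitMass, Pi.single_apply, Prod.ext_iff, and_comm]

theorem marginalSnd_unitMass : marginalSnd (unitMass (G × H)) = unitMass H := by
  rw [← marginalFst_swap, unitMass_swap, marginalFst_unitMass]

/-- The convolution powers of `p`. The new factor is multiplied on the left, so that `convPow p (n +
1)` is visibly a `p`-mixture of left translates of `convPow p n`. -/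
def convPow (p : G → ℝ) : ℕ → G → ℝ
  | 0 => unitMass G
  | n + 1 => conv p (convPow p n)

theorem IsProb.convPow {p : G → ℝ} (hp : IsProb p) (n : ℕ) : IsProb (convPow p n) := by
  induction n with
  | zero => exact isProb_unitMass
  | succ n ih => exact hp.conv ih

theorem IsProb.summable_negMulLog_convPow {p : G → ℝ} (hp : IsProb p)
    (h : Summable fun x => negMulLog (p x)) (n : ℕ) :
    Summable fun x => negMulLog (RandomWalk.convPow p n x) := by
  induction n with
  | zero => exact summable_negMulLog_unitMass
  | succ n ih => exact hp.summable_negMulLog_conv (hp.convPow n) h ih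

theorem marginalFst_convPow {p : G × H → ℝ} (hp : IsProb p) (n : ℕ) :
    marginalFst (convPow p n) = convPow (marginalFst p) n := by
  induction n with
  | zero => exact marginalFst_unitMass
  | succ n ih => rw [convPow, marginalFst_conv hp (hp.convPow n), ih]; rfl

theorem marginalSnd_convPow {p : G × H → ℝ} (hp : IsProb p) (n : ℕ) :
    marginalSnd (convPow p n) = convPow (marginalSnd p) n := by
  induction n with
  | zero => exact marginalSnd_unitMass
  | succ n ih => rw [convPow, marginalSnd_conv hp (hp.convPow n), ih]; rfl

/-- The Markov operator of the right random walk, `avg p f x = ∑ a, p a * f (x * a)`. Its bounded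
fixed points are the bounded harmonic functions. -/
def avg (p : G → ℝ) (f : G → ℝ) (x : G) : ℝ := ∑' a, p a * f (x * a)

theorem IsProb.summable_mul {p : α → ℝ} (hp : IsProb p) {f : α → ℝ} {C : ℝ}
    (hf : ∀ x, |f x| ≤ C) : Summable fun a => p a * f a := by
  refine Summable.of_norm_bounded (hp.hasSum.summable.mul_right C) fun a => ?_
  rw [norm_mul, Real.norm_eq_abs, Real.norm_eq_abs, abs_of_nonneg (hp.nonneg a)]
  exact mul_le_mul_of_nonneg_left (hf a) (hp.nonneg a)

theorem IsProb.abs_avg_le {p : G → ℝ} (hp : IsProb p) {f : G → ℝ} {C : ℝ}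
    (hf : ∀ x, |f x| ≤ C) (x : G) : |avg p f x| ≤ C := by
  have h := tsum_of_norm_bounded (f := fun a => p a * f (x * a)) (hp.hasSum.mul_right C)
    fun a => ?_
  · simpa [avg] using h
  · rw [norm_mul, Real.norm_eq_abs, Real.norm_eq_abs, abs_of_nonneg (hp.nonneg a)]
    exact mul_le_mul_of_nonneg_left (hf _) (hp.nonneg a)

theorem avg_unitMass (f : G → ℝ) : avg (unitMass G) f = f := by
  funext x
  have h := (hasSum_unitMass_mul fun a => f (x * a)).tsum_eq
  rwa [mul_one] at h

theorem avg_conv {p q : G → ℝ} (hp : IsProb p) (hq : IsProb q) {f : G → ℝ} {C : ℝ}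
    (hf : ∀ x, |f x| ≤ C) : avg (conv p q) f = avg p (avg q f) := by
  funext x
  have hs : Summable fun w : G × G => p w.2 * q (w.2⁻¹ * w.1) * f (x * w.1) :=
    (hp.shear hq).swap.summable_mul (f := fun w => f (x * w.1)) (fun _ => hf _)
  have h1 : ∀ y, HasSum (fun a => p a * q (a⁻¹ * y) * f (x * y)) (conv p q y * f (x * y)) :=
    fun y => (hp.hasSum_conv hq y).mul_right _
  have h2 : ∀ a, HasSum (fun y => p a * q (a⁻¹ * y) * f (x * y)) (p a * avg q f (x * a)) := by
    intro a
    have h := (hq.summable_mul (f := fun z => f (x * a * z)) (fun _ => hf _)).hasSum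
    have h' := ((Equiv.mulLeft a⁻¹).hasSum_iff.mpr h).mul_left (p a)
    convert! h' using 2 with y
    simp [mul_assoc]
  rw [avg, avg]
  simp_rw [← (h1 _).tsum_eq, ← (h2 _).tsum_eq]
  exact Summable.tsum_comm (f := fun a y => p a * q (a⁻¹ * y) * f (x * y)) (summable_swap hs)

theorem IsProb.abs_iterate_avg_le {p : G → ℝ} (hp : IsProb p) {f : G → ℝ} {C : ℝ}
    (hf : ∀ x, |f x| ≤ C) (n : ℕ) (x : G) : |(avg p)^[n] f x| ≤ C := by
  induction n generalizing x with
  | zero => exact hf x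
  | succ n ih => rw [Function.iterate_succ_apply']; exact hp.abs_avg_le ih x

theorem avg_convPow {p : G → ℝ} (hp : IsProb p) {f : G → ℝ} {C : ℝ}
    (hf : ∀ x, |f x| ≤ C) (n : ℕ) : avg (convPow p n) f = (avg p)^[n] f := by
  induction n with
  | zero => exact avg_unitMass f
  | succ n ih => rw [convPow, avg_conv hp (hp.convPow n) hf, ih, Function.iterate_succ_apply']

end Group

/-! ### Averaging rate for binomial weights -/

/-- The variance of the symmetric binomial distribution. -/
theorem sum_choose_mul_sq (N : ℕ) :
    ∑ j ∈ Finset.range (N + 1), (N.choose j : ℝ) * (2 * (j : ℝ) - N) ^ 2 = (2 : ℝ) ^ N * N := by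
  have h := congrArg (Polynomial.eval (1 / 2 : ℝ)) (bernsteinPolynomial.variance ℝ N)
  simp only [Polynomial.eval_finsetSum, bernsteinPolynomial, Polynomial.eval_mul,
    Polynomial.eval_pow, Polynomial.eval_sub, Polynomial.eval_X,
    Polynomial.eval_natCast, Polynomial.eval_one, nsmul_eq_mul] at h
  have h2 : ∀ j ∈ Finset.range (N + 1), (N.choose j : ℝ) * (2 * j - N) ^ 2 =
      4 * 2 ^ N * (((N : ℝ) * (1 / 2) - j) ^ 2 *
        ((N.choose j : ℝ) * (1 / 2) ^ j * (1 - 1 / 2) ^ (N - j))) := by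
    intro j hj
    have hj' : j ≤ N := by simpa [Nat.lt_succ_iff] using hj
    have h3 : (1 / 2 : ℝ) ^ j * (1 - 1 / 2) ^ (N - j) = (1 / 2) ^ N := by
      rw [show (1 - 1 / 2 : ℝ) = 1 / 2 by norm_num, ← pow_add, Nat.add_sub_cancel' hj']
    have h4 : (2 : ℝ) ^ N * (1 / 2) ^ N = 1 := by rw [← mul_pow]; norm_num
    rw [mul_assoc (N.choose j : ℝ), h3]
    linear_combination (-(N.choose j : ℝ) * (2 * j - N) ^ 2) * h4
  rw [Finset.sum_congr rfl h2, ← Finset.mul_sum, h]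
  ring

/-- The mean deviation of the symmetric binomial distribution is at most its standard deviation. -/
theorem sum_choose_mul_abs_le (N : ℕ) :
    ∑ j ∈ Finset.range (N + 1), (N.choose j : ℝ) * |2 * (j : ℝ) - N| ≤ 2 ^ N * √N := by
  have h := Finset.sum_mul_sq_le_sq_mul_sq (Finset.range (N + 1))
    (fun j => √(N.choose j : ℝ)) (fun j => √(N.choose j : ℝ) * |2 * (j : ℝ) - N|)
  have e1 : ∀ j, √(N.choose j : ℝ) * (√(N.choose j : ℝ) * |2 * (j : ℝ) - N|) =
      (N.choose j : ℝ) * |2 * (j : ℝ) - N| := fun j => by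
    rw [← mul_assoc, mul_self_sqrt (Nat.cast_nonneg _)]
  have e2 : ∀ j : ℕ, (√(N.choose j : ℝ) * |2 * (j : ℝ) - N|) ^ 2 =
      (N.choose j : ℝ) * (2 * j - N) ^ 2 := fun j => by
    rw [mul_pow, sq_sqrt (Nat.cast_nonneg _), sq_abs]
  simp only [e1, e2, sq_sqrt (Nat.cast_nonneg _), sum_choose_mul_sq] at h
  have e3 : ∑ j ∈ Finset.range (N + 1), (N.choose j : ℝ) = 2 ^ N := by
    exact_mod_cast Nat.sum_range_choose N
  rw [e3] at h
  refine abs_le_of_sq_le_sq' ?_ (by positivity) |>.2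
  rw [mul_pow, sq_sqrt (Nat.cast_nonneg _)]
  linarith

theorem abs_binomial_diff_le (n : ℕ) {v : ℕ → ℝ} {C : ℝ} (hv : ∀ j, |v j| ≤ C) :
    |∑ j ∈ Finset.range (n + 1), (n.choose j : ℝ) * v (j + 1) -
      ∑ j ∈ Finset.range (n + 1), (n.choose j : ℝ) * v j| ≤ 2 ^ (n + 1) * C / √(n + 1) := by
  -- After multiplication by `n + 1` both sums become sums over the row `n + 1` of Pascal's
  -- triangle, with `v j` weighted by `j` and by `n + 1 - j`.
  have hN : (0 : ℝ) < n + 1 := by positivity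
  have h1 : (n + 1 : ℝ) * ∑ j ∈ Finset.range (n + 1), (n.choose j : ℝ) * v (j + 1) =
      ∑ j ∈ Finset.range (n + 2), (j : ℝ) * ((n + 1).choose j) * v j := by
    rw [Finset.sum_range_succ' _ (n + 1), Finset.mul_sum]
    simp only [Nat.cast_zero, zero_mul, add_zero]
    refine Finset.sum_congr rfl fun j _ => ?_
    have : ((n + 1 : ℕ) : ℝ) * n.choose j = (n + 1).choose (j + 1) * (j + 1 : ℕ) := by
      exact_mod_cast Nat.add_one_mul_choose_eq n j
    push_cast at this ⊢
    linear_combination v (j + 1) * this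
  have h2 : (n + 1 : ℝ) * ∑ j ∈ Finset.range (n + 1), (n.choose j : ℝ) * v j =
      ∑ j ∈ Finset.range (n + 2), ((n + 1 : ℝ) - j) * ((n + 1).choose j) * v j := by
    rw [Finset.sum_range_succ _ (n + 1), Finset.mul_sum]
    simp only [Nat.cast_add, Nat.cast_one, sub_self, zero_mul, add_zero]
    refine Finset.sum_congr rfl fun j hj => ?_
    have hj' : j ≤ n + 1 := (Finset.mem_range.mp hj).le
    have : (n.choose j : ℝ) * (n + 1 : ℕ) = (n + 1).choose j * ((n + 1 - j : ℕ) : ℝ) := by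
      exact_mod_cast Nat.choose_mul_succ_eq n j
    rw [Nat.cast_sub hj'] at this
    push_cast at this
    linear_combination v j * this
  have h3 : (n + 1 : ℝ) * |∑ j ∈ Finset.range (n + 1), (n.choose j : ℝ) * v (j + 1) -
      ∑ j ∈ Finset.range (n + 1), (n.choose j : ℝ) * v j| ≤ 2 ^ (n + 1) * √(n + 1) * C := by
    rw [← abs_of_pos hN, ← abs_mul, mul_sub, h1, h2, ← Finset.sum_sub_distrib, abs_of_pos hN]
    refine (Finset.abs_sum_le_sum_abs _ _).trans ?_
    have h4 := sum_choose_mul_abs_le (n + 1)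
    push_cast at h4
    refine le_trans ?_ (mul_le_mul_of_nonneg_right h4 ((abs_nonneg _).trans (hv 0)))
    rw [Finset.sum_mul]
    refine Finset.sum_le_sum fun j _ => ?_
    have e : (j : ℝ) * ((n + 1).choose j) * v j - ((n + 1 : ℝ) - j) * ((n + 1).choose j) * v j =
      ((n + 1).choose j) * (2 * j - (n + 1)) * v j := by ring
    rw [e, abs_mul, abs_mul, Nat.abs_cast]
    exact mul_le_mul_of_nonneg_left (hv j) (by positivity)
  rw [le_div_iff₀ (by positivity)]
  have h5 : √(n + 1 : ℝ) * √(n + 1) = n + 1 := mul_self_sqrt hN.le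
  have h6 : 0 < √(n + 1 : ℝ) := sqrt_pos.mpr hN
  refine le_of_mul_le_mul_right ?_ h6
  rw [mul_assoc, h5]
  linarith

theorem eq_sum_choose_of_average {w : ℕ → ℕ → ℝ}
    (hw : ∀ n k, w (n + 1) k = (w n k + w n (k + 1)) / 2) (n k : ℕ) :
    2 ^ n * w n k = ∑ j ∈ Finset.range (n + 1), (n.choose j : ℝ) * w 0 (k + j) := by
  induction n generalizing k with
  | zero => simp
  | succ n ih =>
    rw [hw, pow_succ, show (2 : ℝ) ^ n * 2 * ((w n k + w n (k + 1)) / 2) =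
      2 ^ n * w n k + 2 ^ n * w n (k + 1) by ring, ih, ih, Finset.sum_range_succ' _ (n + 1)]
    have h1 : ∑ j ∈ Finset.range (n + 1), ((n + 1).choose (j + 1) : ℝ) * w 0 (k + (j + 1)) =
        ∑ j ∈ Finset.range (n + 1), (n.choose j : ℝ) * w 0 (k + 1 + j) +
        ∑ j ∈ Finset.range (n + 1), (n.choose (j + 1) : ℝ) * w 0 (k + (j + 1)) := by
      rw [← Finset.sum_add_distrib]
      refine Finset.sum_congr rfl fun j _ => ?_
      rw [Nat.choose_succ_succ, show k + 1 + j = k + (j + 1) by ring]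
      push_cast; ring
    have h2 : ∑ j ∈ Finset.range (n + 1), (n.choose (j + 1) : ℝ) * w 0 (k + (j + 1)) +
        (n.choose 0 : ℝ) * w 0 (k + 0) =
        ∑ j ∈ Finset.range (n + 1), (n.choose j : ℝ) * w 0 (k + j) := by
      rw [← Finset.sum_range_succ' (fun j => (n.choose j : ℝ) * w 0 (k + j)),
        Finset.sum_range_succ]
      simp
    rw [h1, ← h2]
    simp only [Nat.choose_zero_right]
    ring

/-- If every row of the array `w` is the average of the previous row and its shift, then consecutive
rows approach each other at a rate depending only on a bound for the initial row. -/
theorem abs_average_diff_le {w : ℕ → ℕ → ℝ} {C : ℝ}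
    (hw : ∀ n k, w (n + 1) k = (w n k + w n (k + 1)) / 2) (hC : ∀ k, |w 0 k| ≤ C) (n : ℕ) :
    |w (n + 1) 0 - w n 0| ≤ C / √(n + 1) := by
  have h := abs_binomial_diff_le n hC
  have h1 := eq_sum_choose_of_average hw n 1
  have h0 := eq_sum_choose_of_average hw n 0
  simp only [zero_add, add_comm 1] at h0 h1
  rw [← h0, ← h1, ← mul_sub, abs_mul, abs_of_pos (by positivity), pow_succ, mul_assoc,
    mul_div_assoc,
    mul_le_mul_iff_right₀ (by positivity)] at h
  rw [hw, show (w n 0 + w n (0 + 1)) / 2 - w n 0 = (w n 1 - w n 0) / 2 by ring, abs_div, abs_two]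
  rw [mul_div_assoc] at h
  linarith

/-! ### Bounded harmonic functions and the lazy walk -/

section Lazy

variable [Group G] [Group H]

/-- Every bounded `m`-harmonic function takes at each point of the support of `m` the same value as
at the identity. Applied to left translates of a harmonic function `f` it gives `f (g * a) = f g`
for all `g` and all `a` in the support, i.e. `f` is constant along the steps of the walk. -/
def LiouvilleProperty (m : G → ℝ) : Prop :=
  ∀ (f : G → ℝ) (C : ℝ), (∀ x, |f x| ≤ C) → (∀ x, avg m f x = f x) → ∀ a, m a ≠ 0 → f a = f 1

/-- The step distribution of the lazy walk, which stays put with probability `1 / 2`. -/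
def lazy (m : G → ℝ) (x : G) : ℝ := (unitMass G x + m x) / 2

theorem IsProb.lazy {m : G → ℝ} (hm : IsProb m) : IsProb (lazy m) where
  nonneg x := div_nonneg (add_nonneg (isProb_unitMass.nonneg x) (hm.nonneg x)) zero_le_two
  hasSum := by
    have h := (isProb_unitMass.hasSum.add hm.hasSum).div_const 2
    rwa [one_add_one_eq_two, div_self two_ne_zero] at h

theorem avg_lazy {m : G → ℝ} (hm : IsProb m) {f : G → ℝ} {C : ℝ} (hf : ∀ x, |f x| ≤ C) (x : G) :
    avg (lazy m) f x = (f x + avg m f x) / 2 := by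
  have h1 := hasSum_unitMass_mul fun a => f (x * a)
  rw [mul_one] at h1
  have h2 := (hm.summable_mul (f := fun a => f (x * a)) fun _ => hf _).hasSum
  rw [← avg] at h2
  rw [← ((h1.add h2).div_const 2).tsum_eq]
  refine tsum_congr fun a => ?_
  rw [lazy]; ring

theorem lazy_ne_zero {m : G → ℝ} (hm : IsProb m) {a : G} (ha : m a ≠ 0) : lazy m a ≠ 0 := by
  have h1 := isProb_unitMass.nonneg a
  have h2 := (hm.nonneg a).lt_of_ne' ha
  exact (div_pos (add_pos_of_nonneg_of_pos h1 h2) two_pos).ne'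

theorem LiouvilleProperty.lazy {m : G → ℝ} (hm : IsProb m) (h : LiouvilleProperty m) :
    LiouvilleProperty (lazy m) := by
  intro f C hf hh a ha
  by_cases h1 : a = 1
  · rw [h1]
  refine h f C hf (fun x => ?_) a fun h0 => ha ?_
  · have := hh x
    rw [avg_lazy hm hf] at this
    linarith
  · simp [RandomWalk.lazy, h0, unitMass, h1]

theorem LiouvilleProperty.of_lazy {m : G → ℝ} (hm : IsProb m)
    (h : LiouvilleProperty (RandomWalk.lazy m)) : LiouvilleProperty m := by
  intro f C hf hh a ha
  refine h f C hf (fun x => ?_) a (lazy_ne_zero hm ha)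
  rw [avg_lazy hm hf, hh]
  ring

/-- Laziness preserves finiteness of the entropy: away from the identity it only halves the
masses. -/
theorem summable_negMulLog_lazy {m : G → ℝ} (hm : IsProb m)
    (h : Summable fun x => negMulLog (m x)) : Summable fun x => negMulLog (lazy m x) := by
  classical
  have h2 : Summable fun x => m x * negMulLog (1 / 2) + 1 / 2 * negMulLog (m x) :=
    (hm.hasSum.summable.mul_right _).add (h.mul_left _)
  refine h2.congr_cofinite ?_
  refine (Set.finite_singleton (1 : G)).subset fun x hx => ?_
  by_contra h1
  refine hx ?_
  have h1' : x ≠ 1 := h1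
  have h3 : lazy m x = m x / 2 := by simp [lazy, unitMass, h1']
  show _ = negMulLog (lazy m x)
  rw [h3, show m x / 2 = 1 / 2 * m x by ring, negMulLog_mul]

theorem marginalFst_lazy {m : G × H → ℝ} (hm : IsProb m) :
    marginalFst (lazy m) = lazy (marginalFst m) := by
  funext a
  have h1 := (isProb_unitMass (G := G × H)).hasSum_fst a
  rw [marginalFst_unitMass] at h1
  exact ((h1.add (hm.hasSum_fst a)).div_const 2).tsum_eq

theorem marginalSnd_lazy {m : G × H → ℝ} (hm : IsProb m) :
    marginalSnd (lazy m) = lazy (marginalSnd m) := by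
  funext a
  have h1 := (isProb_unitMass (G := G × H)).hasSum_snd a
  rw [marginalSnd_unitMass] at h1
  exact ((h1.add (hm.hasSum_snd a)).div_const 2).tsum_eq

/-- For the lazy Markov operator `P = (1 + M) / 2` the norm of `P ^ (n + 1) - P ^ n` on bounded
functions is at most `1 / √(n + 1)`. -/
theorem abs_iterate_avg_lazy_sub_le {m : G → ℝ} (hm : IsProb m) {f : G → ℝ} {C : ℝ}
    (hf : ∀ x, |f x| ≤ C) (n : ℕ) (x : G) :
    |(avg (lazy m))^[n + 1] f x - (avg (lazy m))^[n] f x| ≤ C / √(n + 1) := by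
  have hb : ∀ k y, |(avg m)^[k] f y| ≤ C := hm.abs_iterate_avg_le hf
  refine abs_average_diff_le (w := fun n k => (avg (lazy m))^[n] ((avg m)^[k] f) x) (C := C)
    (fun n k => ?_) (fun k => hb k x) n
  have hq := hm.lazy.convPow n
  have e : avg (lazy m) ((avg m)^[k] f) =
      fun y => ((avg m)^[k] f y + (avg m)^[k + 1] f y) / 2 := by
    funext y
    rw [avg_lazy hm (hb k), Function.iterate_succ_apply']
  have hb' : ∀ y, |((avg m)^[k] f y + (avg m)^[k + 1] f y) / 2| ≤ C := fun y => by
    rw [abs_div, abs_two]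
    have := abs_add_le ((avg m)^[k] f y) ((avg m)^[k + 1] f y)
    have := hb k y
    have := hb (k + 1) y
    linarith
  rw [Function.iterate_succ_apply, e, ← avg_convPow hm.lazy hb' n,
    ← avg_convPow hm.lazy (hb k) n, ← avg_convPow hm.lazy (hb (k + 1)) n]
  have h1 := (hq.summable_mul (f := fun a => (avg m)^[k] f (x * a)) fun _ => hb k _).hasSum
  have h2 := (hq.summable_mul (f := fun a => (avg m)^[k + 1] f (x * a))
    fun _ => hb (k + 1) _).hasSum
  rw [avg, avg, avg, ← ((h1.add h2).div_const 2).tsum_eq]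
  refine tsum_congr fun a => ?_
  ring

theorem tendsto_avg {p : G → ℝ} (hp : IsProb p) {F : ℕ → G → ℝ} {f : G → ℝ} {C : ℝ}
    (hF : ∀ n x, |F n x| ≤ C) (h : Tendsto F atTop (𝓝 f)) (x : G) :
    Tendsto (fun n => avg p (F n) x) atTop (𝓝 (avg p f x)) := by
  refine tendsto_tsum_of_dominated_convergence (hp.hasSum.summable.mul_right C) (fun a => ?_)
    (Eventually.of_forall fun n a => ?_)
  · exact (tendsto_pi_nhds.mp h (x * a)).const_mul _
  · rw [norm_mul, Real.norm_eq_abs, Real.norm_eq_abs, abs_of_nonneg (hp.nonneg a)]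
    exact mul_le_mul_of_nonneg_left (hF _ _) (hp.nonneg a)

/-- The `ℓ¹` distance between the left translate by `a` of the `n`-th convolution power of `p` and
the `(n + 1)`-st convolution power. -/
def translationGap (p : G → ℝ) (a : G) (n : ℕ) : ℝ :=
  ∑' y, |convPow p n (a⁻¹ * y) - convPow p (n + 1) y|

theorem IsProb.translate {p : G → ℝ} (hp : IsProb p) (a : G) : IsProb fun y => p (a⁻¹ * y) :=
  hp.comp_equiv (Equiv.mulLeft a⁻¹)

theorem IsProb.summable_abs_sub {p q : α → ℝ} (hp : IsProb p) (hq : IsProb q) :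
    Summable fun y => |p y - q y| :=
  (hp.hasSum.summable.sub hq.hasSum.summable).abs

theorem avg_sub_avg {p q : G → ℝ} (hp : IsProb p) (hq : IsProb q) {f : G → ℝ} {C : ℝ}
    (hf : ∀ x, |f x| ≤ C) (a : G) :
    HasSum (fun y => (p (a⁻¹ * y) - q y) * f y) (avg p f a - avg q f 1) := by
  have h1 := (hp.summable_mul (f := fun y => f (a * y)) fun _ => hf _).hasSum
  have h2 := (hq.summable_mul (f := fun y => f (1 * y)) fun _ => hf _).hasSum
  convert! ((Equiv.mulLeft a⁻¹).hasSum_iff.mpr h1).sub h2 using 2 with y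
  simp [sub_mul]

/-- If the lazy walk has only trivial bounded harmonic functions, then its convolution powers are
asymptotically invariant under the elements of the support. -/
theorem tendsto_translationGap [Countable G] {m : G → ℝ} (hm : IsProb m)
    (h : LiouvilleProperty (lazy m)) {a : G} (ha : lazy m a ≠ 0) :
    Tendsto (translationGap (lazy m) a) atTop (𝓝 0) := by
  set p := lazy m with hp_def
  have hp : IsProb p := hm.lazy
  by_contra hcon
  have h0 : ∀ n, 0 ≤ translationGap p a n := fun n => tsum_nonneg fun _ => abs_nonneg _
  obtain ⟨ε, hε, φ, hφ, hT⟩ : ∃ ε > 0, ∃ φ : ℕ → ℕ, StrictMono φ ∧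
      ∀ k, ε ≤ translationGap p a (φ k) := by
    rw [Metric.tendsto_atTop] at hcon
    push Not at hcon
    obtain ⟨ε, hε, hf⟩ := hcon
    obtain ⟨φ, hφ, hT⟩ := Filter.extraction_of_frequently_atTop
      (P := fun n => ε ≤ translationGap p a n) (Filter.frequently_atTop.mpr fun N => by
        obtain ⟨n, hn, hd⟩ := hf N
        refine ⟨n, hn, ?_⟩
        rwa [Real.dist_eq, sub_zero, abs_of_nonneg (h0 n)] at hd)
    exact ⟨ε, hε, φ, hφ, hT⟩
  -- `s n` is the sign function that computes the `ℓ¹` norm of the `n`-th difference.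
  let s : ℕ → G → ℝ := fun n y =>
    if 0 ≤ convPow p n (a⁻¹ * y) - convPow p (n + 1) y then 1 else -1
  have hs : ∀ n y, |s n y| ≤ 1 := fun n y => by simp only [s]; split_ifs <;> simp
  have hsT : ∀ n, (avg p)^[n] (s n) a - (avg p)^[n + 1] (s n) 1 = translationGap p a n := by
    intro n
    rw [← avg_convPow hp (hs n), ← avg_convPow hp (hs n),
      ← (avg_sub_avg (hp.convPow n) (hp.convPow (n + 1)) (hs n) a).tsum_eq]
    refine tsum_congr fun y => ?_
    simp only [s]
    split_ifs with hy
    · rw [mul_one, abs_of_nonneg hy]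
    · rw [abs_of_neg (not_le.mp hy)]; ring
  -- The functions `F n` are almost harmonic; a pointwise limit `f` of a subsequence is harmonic.
  let F : ℕ → G → ℝ := fun n => (avg p)^[n] (s n)
  have hF : ∀ n x, |F n x| ≤ 1 := fun n => hp.abs_iterate_avg_le (hs n) n
  obtain ⟨f, hf, ψ, hψ, hlim⟩ := (isCompact_univ_pi fun _ : G => isCompact_Icc (a := (-1 : ℝ))
    (b := 1)).tendsto_subseq (x := fun k => F (φ k)) fun k x _ => abs_le.mp (hF _ x)
  have hfb : ∀ x, |f x| ≤ 1 := fun x => abs_le.mpr (hf x (Set.mem_univ x))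
  have hmono : Tendsto (fun k => φ (ψ k)) atTop atTop := (hφ.comp hψ).tendsto_atTop
  have havg := tendsto_avg hp (fun k x => hF (φ (ψ k)) x) hlim
  have hharm : ∀ x, avg p f x = f x := by
    intro x
    have h1 := (havg x).sub (tendsto_pi_nhds.mp hlim x)
    have h2 : Tendsto (fun n : ℕ => (1 : ℝ) / √((n : ℝ) + 1)) atTop (𝓝 0) := by
      refine tendsto_const_nhds.div_atTop ?_
      exact tendsto_sqrt_atTop.comp (tendsto_atTop_add_const_right _ _ tendsto_natCast_atTop_atTop)
    refine sub_eq_zero.mp (tendsto_nhds_unique h1 (squeeze_zero_norm (fun k => ?_)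
      (h2.comp hmono)))
    have := abs_iterate_avg_lazy_sub_le hm (hs (φ (ψ k))) (φ (ψ k)) x
    rw [Function.iterate_succ_apply'] at this
    exact this
  have h4 : Tendsto (fun k => translationGap p a (φ (ψ k))) atTop (𝓝 (f a - avg p f 1)) := by
    refine ((tendsto_pi_nhds.mp hlim a).sub (havg 1)).congr fun k => ?_
    rw [← hsT, Function.iterate_succ_apply']
    rfl
  have h5 : ε ≤ f a - avg p f 1 := ge_of_tendsto' h4 fun k => hT _
  rw [hharm, h f 1 hfb hharm a ha, sub_self] at h5
  linarith

end Lazy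

/-! ### Relative entropy of translates -/

/-- The nonnegative integrand `s log (s / t) + t - s` of the relative entropy. For probability
vectors the correction `t - s` sums to `0`. With `log 0 = 0` the value is meaningful if `t = 0`
implies `s = 0`. -/
def klTerm (s t : ℝ) : ℝ := s * log s - s * log t + t - s

theorem klTerm_le_of_mul_le {s t c : ℝ} (hc : 0 < c) (hs : 0 ≤ s) (h : c * s ≤ t) :
    klTerm s t ≤ s * (-log c) + t - s := by
  rcases hs.eq_or_lt with h0 | h0
  · simp [klTerm, ← h0]
  · have := log_le_log (mul_pos hc h0) h
    rw [log_mul hc.ne' h0.ne'] at this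
    rw [klTerm]
    nlinarith

theorem klTerm_le_abs_sub_div {s t c : ℝ} (hc : 0 < c) (hc1 : c ≤ 1) (hs : 0 ≤ s) (ht : 0 ≤ t)
    (h : c * s ≤ t) : klTerm s t ≤ |s - t| / c := by
  have hc' : t ≤ t / c := by rw [le_div_iff₀ hc]; nlinarith
  rcases hs.eq_or_lt with h0 | h0
  · rw [← h0, zero_sub, abs_neg, abs_of_nonneg ht]
    simpa [klTerm] using hc'
  have ht0 : 0 < t := (mul_pos hc h0).trans_le h
  have h1 := log_le_sub_one_of_pos (div_pos h0 ht0)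
  rw [log_div h0.ne' ht0.ne'] at h1
  have h2 := mul_le_mul_of_nonneg_left h1 hs
  have h3 : klTerm s t ≤ |s - t| * (|s - t| / t) := by
    have : |s - t| * (|s - t| / t) = s * (s / t - 1) + t - s := by
      rw [← mul_div_assoc, abs_mul_abs_self]
      field_simp
      ring
    rw [this, klTerm]
    linarith
  refine h3.trans ?_
  rw [div_eq_mul_inv |s - t| c]
  refine mul_le_mul_of_nonneg_left ?_ (abs_nonneg _)
  rw [div_le_iff₀ ht0, inv_mul_eq_div, abs_le]
  have h4 : s ≤ t / c := by rw [le_div_iff₀ hc]; linarith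
  constructor <;> linarith

/-- Relative entropy dominates the squared Hellinger distance. -/
theorem sq_sqrt_sub_sqrt_le_klTerm {s t : ℝ} (hs : 0 ≤ s) (ht : 0 ≤ t) (h : t = 0 → s = 0) :
    (√s - √t) ^ 2 ≤ klTerm s t := by
  rcases hs.eq_or_lt with h0 | h0
  · simp [klTerm, ← h0, sq_sqrt ht]
  have ht0 : 0 < t := ht.lt_of_ne fun h1 => h0.ne' (h h1.symm)
  have h1 := log_le_sub_one_of_pos (div_pos (sqrt_pos.mpr ht0) (sqrt_pos.mpr h0))
  rw [log_div (sqrt_pos.mpr ht0).ne' (sqrt_pos.mpr h0).ne', log_sqrt hs, log_sqrt ht] at h1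
  have h2 := mul_le_mul_of_nonneg_left h1 hs
  have h3 : s * (√t / √s - 1) = √s * √t - s := by
    rw [mul_sub, mul_one, mul_div_assoc', mul_comm s, mul_div_assoc, div_sqrt, mul_comm]
  rw [h3] at h2
  rw [klTerm, sub_sq, sq_sqrt hs, sq_sqrt ht]
  linarith

theorem klTerm_nonneg {s t : ℝ} (hs : 0 ≤ s) (ht : 0 ≤ t) (h : t = 0 → s = 0) :
    0 ≤ klTerm s t :=
  (sq_nonneg _).trans (sq_sqrt_sub_sqrt_le_klTerm hs ht h)

/-- A Pinsker type inequality, with a non-optimal constant: the square of the `ℓ¹` distance is at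
most four times the relative entropy. -/
theorem sq_tsum_abs_sub_le {p q : α → ℝ} (hp : IsProb p) (hq : IsProb q)
    (h0 : ∀ x, q x = 0 → p x = 0) (hk : Summable fun x => klTerm (p x) (q x)) :
    (∑' x, |p x - q x|) ^ 2 ≤ 4 * ∑' x, klTerm (p x) (q x) := by
  set D := ∑' x, klTerm (p x) (q x)
  have hD : 0 ≤ D := tsum_nonneg fun x => klTerm_nonneg (hp.nonneg x) (hq.nonneg x) (h0 x)
  -- Cauchy-Schwarz for `|p - q| = |√p - √q| * (√p + √q)`.
  have hle : ∑' x, |p x - q x| ≤ 2 * √D := by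
    refine Real.tsum_le_of_sum_le (fun x => abs_nonneg _) fun s => ?_
    have hcs := Finset.sum_mul_sq_le_sq_mul_sq s (fun x => |√(p x) - √(q x)|)
      (fun x => √(p x) + √(q x))
    have e1 : ∀ x, |√(p x) - √(q x)| * (√(p x) + √(q x)) = |p x - q x| := fun x => by
      rw [← abs_of_nonneg (add_nonneg (sqrt_nonneg (p x)) (sqrt_nonneg (q x))), ← abs_mul,
        mul_comm, ← sq_sub_sq, sq_sqrt (hp.nonneg x), sq_sqrt (hq.nonneg x)]
    simp only [e1, sq_abs] at hcs
    have b1 : ∑ x ∈ s, (√(p x) - √(q x)) ^ 2 ≤ D :=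
      (Finset.sum_le_sum fun x _ =>
        sq_sqrt_sub_sqrt_le_klTerm (hp.nonneg x) (hq.nonneg x) (h0 x)).trans
        (hk.sum_le_tsum s fun x _ => klTerm_nonneg (hp.nonneg x) (hq.nonneg x) (h0 x))
    have b2 : ∑ x ∈ s, (√(p x) + √(q x)) ^ 2 ≤ 4 := by
      have c1 : ∑ x ∈ s, (√(p x) + √(q x)) ^ 2 ≤ ∑ x ∈ s, 2 * (p x + q x) :=
        Finset.sum_le_sum fun x _ => by
          have := sq_sqrt (hp.nonneg x)
          have := sq_sqrt (hq.nonneg x)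
          nlinarith [sq_nonneg (√(p x) - √(q x))]
      have c2 := sum_le_hasSum s (fun x _ => add_nonneg (hp.nonneg x) (hq.nonneg x))
        (hp.hasSum.add hq.hasSum)
      rw [← Finset.mul_sum] at c1
      linarith
    refine abs_le_of_sq_le_sq' (hcs.trans ?_) (by positivity) |>.2
    rw [mul_pow, sq_sqrt hD]
    have := mul_le_mul b1 b2 (Finset.sum_nonneg fun x _ => sq_nonneg _) hD
    linarith
  calc (∑' x, |p x - q x|) ^ 2 ≤ (2 * √D) ^ 2 :=
        pow_le_pow_left₀ (tsum_nonneg fun x => abs_nonneg _) hle 2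
    _ = 4 * D := by rw [mul_pow, sq_sqrt hD]; norm_num

section EntropyGrowth

variable [Group G] [Group H]

/-- The relative entropy of the left translate by `a` of `q` with respect to `r`. With
`r = conv p q` it is meaningful only if `p a ≠ 0`, so it always comes with the factor `p a` or this
assumption. -/
def translateDiv (q r : G → ℝ) (a : G) : ℝ := ∑' y, klTerm (q (a⁻¹ * y)) (r y)

section Gap

variable {p q : G → ℝ}

theorem mul_le_conv (hp : IsProb p) (hq : IsProb q) (a y : G) :
    p a * q (a⁻¹ * y) ≤ conv p q y :=
  le_hasSum (hp.hasSum_conv hq y) a fun b _ => mul_nonneg (hp.nonneg b) (hq.nonneg _)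

theorem eq_zero_of_conv_eq_zero (hp : IsProb p) (hq : IsProb q) {a : G} (ha : p a ≠ 0) (y : G)
    (h : conv p q y = 0) : q (a⁻¹ * y) = 0 := by
  have h1 := mul_le_conv hp hq a y
  rw [h] at h1
  have h2 := le_antisymm h1 (mul_nonneg (hp.nonneg a) (hq.nonneg _))
  exact (mul_eq_zero.mp h2).resolve_left ha

theorem mul_klTerm_nonneg (hp : IsProb p) (hq : IsProb q) (a y : G) :
    0 ≤ p a * klTerm (q (a⁻¹ * y)) (conv p q y) := by
  by_cases ha : p a = 0
  · simp [ha]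
  · exact mul_nonneg (hp.nonneg a) (klTerm_nonneg (hq.nonneg _) ((hp.conv hq).nonneg y)
      (eq_zero_of_conv_eq_zero hp hq ha y))

/-- The entropy gained by convolving `q` with `p`, as a double sum of relative entropy terms. -/
theorem hasSum_klTerm_prod (hp : IsProb p) (hq : IsProb q)
    (hp' : Summable fun x => negMulLog (p x)) (hq' : Summable fun x => negMulLog (q x)) :
    HasSum (fun z : G × G => p z.1 * klTerm (q (z.1⁻¹ * z.2)) (conv p q z.2))
      (shannon (conv p q) - shannon q) := by
  have hr := hp.conv hq
  have s1 : HasSum (fun z : G × G => p z.1 * negMulLog (q (z.1⁻¹ * z.2))) (shannon q) := by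
    have := (shear G).hasSum_iff.mpr
      (hasSum_mul_prod hp.nonneg hq.negMulLog_nonneg hp.hasSum hq'.hasSum)
    rwa [one_mul] at this
  have s2 : HasSum (fun z : G × G => p z.1 * q (z.1⁻¹ * z.2) * (-log (conv p q z.2)))
      (shannon (conv p q)) := by
    rw [← (Equiv.prodComm G G).hasSum_iff]
    refine hasSum_prod_of_nonneg
      (fun z => mul_nonneg ((hp.shear hq).nonneg _)
        (neg_nonneg.mpr (log_nonpos (hr.nonneg _) (hr.le_one _))))
      (fun y => ?_) (hp.summable_negMulLog_conv hq hp' hq').hasSum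
    have := (hp.hasSum_conv hq y).mul_right (-log (conv p q y))
    rw [mul_neg, ← neg_mul] at this
    exact this
  have s3 := hp.prod hr
  have s4 := hp.shear hq
  have := ((s2.sub s1).add s3.hasSum).sub s4.hasSum
  rw [add_sub_cancel_right] at this
  convert! this using 2 with z
  rw [klTerm, negMulLog]
  ring

/-- The entropy gained by convolving `q` with `p` is the mean relative entropy of the translates of
`q` with respect to their mixture `conv p q`. -/
theorem hasSum_mul_translateDiv (hp : IsProb p) (hq : IsProb q)
    (hp' : Summable fun x => negMulLog (p x)) (hq' : Summable fun x => negMulLog (q x)) :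
    HasSum (fun a => p a * translateDiv q (conv p q) a) (shannon (conv p q) - shannon q) := by
  have h := hasSum_klTerm_prod hp hq hp' hq'
  refine h.prod_fiberwise fun a => ?_
  have h2 := (h.summable.prod_factor a).hasSum
  simp only [tsum_mul_left] at h2
  exact h2

theorem summable_klTerm (hp : IsProb p) (hq : IsProb q)
    (hp' : Summable fun x => negMulLog (p x)) (hq' : Summable fun x => negMulLog (q x)) {a : G}
    (ha : p a ≠ 0) : Summable fun y => klTerm (q (a⁻¹ * y)) (conv p q y) :=
  (summable_mul_left_iff ha).mp ((hasSum_klTerm_prod hp hq hp' hq').summable.prod_factor a)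

theorem mul_translateDiv_nonneg (hp : IsProb p) (hq : IsProb q) (a : G) :
    0 ≤ p a * translateDiv q (conv p q) a := by
  rw [translateDiv, ← tsum_mul_left]
  exact tsum_nonneg fun y => mul_klTerm_nonneg hp hq a y

theorem translateDiv_le_neg_log (hp : IsProb p) (hq : IsProb q)
    (hp' : Summable fun x => negMulLog (p x)) (hq' : Summable fun x => negMulLog (q x)) {a : G}
    (ha : p a ≠ 0) : translateDiv q (conv p q) a ≤ -log (p a) := by
  have h1 := (((hq.translate a).hasSum.mul_right (-log (p a))).add (hp.conv hq).hasSum).sub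
    (hq.translate a).hasSum
  rw [add_sub_cancel_right, one_mul] at h1
  exact hasSum_le (fun y => klTerm_le_of_mul_le ((hp.nonneg a).lt_of_ne' ha) (hq.nonneg _)
    (mul_le_conv hp hq a y)) (summable_klTerm hp hq hp' hq' ha).hasSum h1

theorem translateDiv_le_abs_sub (hp : IsProb p) (hq : IsProb q)
    (hp' : Summable fun x => negMulLog (p x)) (hq' : Summable fun x => negMulLog (q x)) {a : G}
    (ha : p a ≠ 0) :
    translateDiv q (conv p q) a ≤ (∑' y, |q (a⁻¹ * y) - conv p q y|) / p a := by
  have h1 := ((hq.translate a).summable_abs_sub (hp.conv hq)).hasSum.div_const (p a)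
  exact hasSum_le (fun y => klTerm_le_abs_sub_div ((hp.nonneg a).lt_of_ne' ha) (hp.le_one a)
    (hq.nonneg _) ((hp.conv hq).nonneg y) (mul_le_conv hp hq a y))
    (summable_klTerm hp hq hp' hq' ha).hasSum h1

end Gap

/-! ### Entropy growth and the Liouville property -/

/-- Asymptotic invariance of the convolution powers makes their entropy increments tend to `0`. -/
theorem tendsto_shannon_convPow_diff {p : G → ℝ} (hp : IsProb p)
    (hp' : Summable fun x => negMulLog (p x))
    (h : ∀ a, p a ≠ 0 → Tendsto (translationGap p a) atTop (𝓝 0)) :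
    Tendsto (fun n => shannon (convPow p (n + 1)) - shannon (convPow p n)) atTop (𝓝 0) := by
  have hq := hp.convPow
  have hq' := hp.summable_negMulLog_convPow hp'
  have key : Tendsto (fun n => ∑' a, p a * translateDiv (convPow p n) (convPow p (n + 1)) a)
      atTop (𝓝 (∑' _ : G, 0)) := by
    refine tendsto_tsum_of_dominated_convergence hp' (fun a => ?_)
      (Eventually.of_forall fun n a => ?_)
    · by_cases ha : p a = 0
      · simp [ha]
      · refine squeeze_zero (fun n => mul_translateDiv_nonneg hp (hq n) a) (fun n => ?_) (h a ha)
        have := translateDiv_le_abs_sub hp (hq n) hp' (hq' n) ha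
        rw [le_div_iff₀ ((hp.nonneg a).lt_of_ne' ha), mul_comm] at this
        exact this
    · rw [Real.norm_eq_abs, convPow, abs_of_nonneg (mul_translateDiv_nonneg hp (hq n) a)]
      by_cases ha : p a = 0
      · simp [ha]
      · have := mul_le_mul_of_nonneg_left (translateDiv_le_neg_log hp (hq n) hp' (hq' n) ha)
          (hp.nonneg a)
        rwa [mul_neg, ← neg_mul] at this
  rw [tsum_zero] at key
  exact key.congr fun n => (hasSum_mul_translateDiv hp (hq n) hp' (hq' n)).tsum_eq

/-- If the entropy increments of the convolution powers come arbitrarily close to `0`, then bounded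
harmonic functions are trivial. -/
theorem LiouvilleProperty.of_shannon_diff {p : G → ℝ} (hp : IsProb p)
    (hp' : Summable fun x => negMulLog (p x))
    (h : ∀ δ > 0, ∃ n, shannon (convPow p (n + 1)) - shannon (convPow p n) < δ) :
    LiouvilleProperty p := by
  intro f C hf hh a ha
  have hq := hp.convPow
  have hq' := hp.summable_negMulLog_convPow hp'
  have hpa : 0 < p a := (hp.nonneg a).lt_of_ne' ha
  have hharm : ∀ n, avg (convPow p n) f = f := fun n => by
    rw [avg_convPow hp hf]
    exact Function.iterate_fixed (funext hh) n
  have hC : 0 ≤ C := (abs_nonneg _).trans (hf 1)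
  have hT : ∀ n, |f a - f 1| ≤ translationGap p a n * C := fun n => by
    have h1 := avg_sub_avg (hq n) (hq (n + 1)) hf a
    rw [hharm, hharm] at h1
    rw [← h1.tsum_eq, ← Real.norm_eq_abs]
    refine tsum_of_norm_bounded
      ((((hq n).translate a).summable_abs_sub (hq (n + 1))).hasSum.mul_right C) fun y => ?_
    rw [norm_mul]
    exact mul_le_mul_of_nonneg_left (hf y) (norm_nonneg _)
  have hT2 : ∀ n, p a * translationGap p a n ^ 2 ≤
      4 * (shannon (convPow p (n + 1)) - shannon (convPow p n)) := fun n => by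
    have h1 := sq_tsum_abs_sub_le ((hq n).translate a) (hq (n + 1))
      (eq_zero_of_conv_eq_zero hp (hq n) ha) (summable_klTerm hp (hq n) hp' (hq' n) ha)
    have h2 := le_hasSum (hasSum_mul_translateDiv hp (hq n) hp' (hq' n)) a
      fun b _ => mul_translateDiv_nonneg hp (hq n) b
    have h3 := mul_le_mul_of_nonneg_left h1 hpa.le
    rw [translationGap]
    rw [translateDiv] at h2
    simp only [convPow] at h1 h2 h3 ⊢
    linarith
  -- By `hT` and `hT2` the left side is at most `4 * C ^ 2` times every entropy increment; the
  -- `+ 1` in the choice of `n` only keeps the denominator positive.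
  have hsq : p a * |f a - f 1| ^ 2 ≤ 0 := by
    refine le_of_forall_pos_lt_add fun δ hδ => ?_
    obtain ⟨n, hn⟩ := h (δ / (4 * C ^ 2 + 1)) (by positivity)
    rw [lt_div_iff₀ (by positivity)] at hn
    have h0 : 0 ≤ shannon (convPow p (n + 1)) - shannon (convPow p n) :=
      (hasSum_mul_translateDiv hp (hq n) hp' (hq' n)).nonneg
        fun b => mul_translateDiv_nonneg hp (hq n) b
    have h1 := pow_le_pow_left₀ (abs_nonneg _) (hT n) 2
    have h2 := mul_le_mul_of_nonneg_left h1 hpa.le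
    have h3 := mul_le_mul_of_nonneg_right (hT2 n) (sq_nonneg C)
    rw [mul_pow] at h2
    linarith
  have : |f a - f 1| ^ 2 ≤ 0 := nonpos_of_mul_nonpos_right hsq hpa
  have h5 := pow_eq_zero_iff two_ne_zero |>.mp (le_antisymm this (sq_nonneg _))
  exact sub_eq_zero.mp (abs_eq_zero.mp h5)

/-- A nonnegative sequence below a sequence with increments tending to `0` has arbitrarily small
increments, since otherwise it would grow linearly. -/
theorem exists_diff_lt {u v : ℕ → ℝ} (hv0 : ∀ n, 0 ≤ v n) (hvu : ∀ n, v n ≤ u n)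
    (hu : Tendsto (fun n => u (n + 1) - u n) atTop (𝓝 0)) {δ : ℝ} (hδ : 0 < δ) :
    ∃ n, v (n + 1) - v n < δ := by
  by_contra! hcon
  obtain ⟨N, hN⟩ := eventually_atTop.mp (hu.eventually_lt_const (half_pos hδ))
  have h1 : ∀ k : ℕ, u (N + k) ≤ u N + k * (δ / 2) := fun k => by
    induction k with
    | zero => simp
    | succ k ih =>
      have := hN (N + k) (Nat.le_add_right _ _)
      push_cast
      rw [← add_assoc]
      linarith
  have h2 : ∀ k : ℕ, k * δ ≤ v (N + k) := fun k => by
    induction k with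
    | zero => simpa using hv0 N
    | succ k ih =>
      have := hcon (N + k)
      push_cast
      rw [← add_assoc]
      linarith
  obtain ⟨k, hk⟩ := exists_nat_gt (u N / (δ / 2))
  rw [div_lt_iff₀ (half_pos hδ)] at hk
  have := h1 k
  have := h2 k
  have := hvu (N + k)
  linarith

/-- A finite entropy distribution on a product has the Liouville property if its marginals do. -/
theorem LiouvilleProperty.prod [Countable G] [Countable H] {m : G × H → ℝ} (hm : IsProb m)
    (hm' : Summable fun z => negMulLog (m z)) (h1 : LiouvilleProperty (marginalFst m))
    (h2 : LiouvilleProperty (marginalSnd m)) : LiouvilleProperty m := by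
  refine LiouvilleProperty.of_lazy hm ?_
  have hp := hm.lazy
  have hp' := summable_negMulLog_lazy hm hm'
  refine LiouvilleProperty.of_shannon_diff hp hp' fun δ hδ => ?_
  have d1 : Tendsto (fun n => shannon (convPow (marginalFst (RandomWalk.lazy m)) (n + 1)) -
      shannon (convPow (marginalFst (RandomWalk.lazy m)) n)) atTop (𝓝 0) := by
    refine tendsto_shannon_convPow_diff hp.marginalFst (hp.summable_negMulLog_fst hp') ?_
    rw [marginalFst_lazy hm]
    exact fun a ha => tendsto_translationGap hm.marginalFst (h1.lazy hm.marginalFst) ha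
  have d2 : Tendsto (fun n => shannon (convPow (marginalSnd (RandomWalk.lazy m)) (n + 1)) -
      shannon (convPow (marginalSnd (RandomWalk.lazy m)) n)) atTop (𝓝 0) := by
    refine tendsto_shannon_convPow_diff hp.marginalSnd (hp.summable_negMulLog_snd hp') ?_
    rw [marginalSnd_lazy hm]
    exact fun a ha => tendsto_translationGap hm.marginalSnd (h2.lazy hm.marginalSnd) ha
  refine exists_diff_lt (u := fun n => shannon (convPow (marginalFst (RandomWalk.lazy m)) n) +
    shannon (convPow (marginalSnd (RandomWalk.lazy m)) n)) (fun n => (hp.convPow n).shannon_nonneg)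
    (fun n => ?_) ?_ hδ
  · rw [← marginalFst_convPow hp, ← marginalSnd_convPow hp]
    exact (hp.convPow n).shannon_le_add (hp.summable_negMulLog_convPow hp' n)
  · have := d1.add d2
    rw [add_zero] at this
    exact this.congr fun n => by ring

end EntropyGrowth

end Series

/-! ### The law of the increments -/

section Increments

variable {G : Type*}

/-- The sequence `(a, h 0, h 1, …)`. -/
def prepend {G : Type*} (a : G) (h : ℕ → G) : ℕ → G
  | 0 => a
  | t + 1 => h t

theorem prepend_mem_pi_range_succ (a : G) (h : ℕ → G) (N : ℕ) (t : ℕ → Set G) :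
    prepend a h ∈ Set.pi (Finset.range (N + 1)) t ↔
      a ∈ t 0 ∧ h ∈ Set.pi (Finset.range N) fun i => t (i + 1) := by
  simp only [Set.mem_pi, Finset.mem_coe, Finset.mem_range]
  constructor
  · exact fun hx => ⟨hx 0 (Nat.succ_pos N), fun i hi => hx (i + 1) (Nat.succ_lt_succ hi)⟩
  · rintro ⟨h0, h1⟩ (_ | i) hi
    exacts [h0, h1 i (Nat.lt_of_succ_lt_succ hi)]

variable [MeasurableSpace G]

theorem measurable_prepend : Measurable fun p : G × (ℕ → G) => prepend p.1 p.2 := by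
  refine measurable_pi_iff.mpr fun t => ?_
  cases t with
  | zero => exact measurable_fst
  | succ t => exact (measurable_pi_apply t).comp measurable_snd

/-- The law of the sequence of increments of the random walk: independent, `μ`-distributed. -/
abbrev incrementLaw (μ : Measure G) : Measure (ℕ → G) := Measure.infinitePi fun _ : ℕ => μ

/-- The law of the increments is determined by the boxes over initial segments of `ℕ`. -/
theorem eq_incrementLaw {μ : Measure G} [IsProbabilityMeasure μ] {m : Measure (ℕ → G)}
    (hm : ∀ (N : ℕ) (t : ℕ → Set G), (∀ i, MeasurableSet (t i)) →
      m (Set.pi (Finset.range N) t) = ∏ i ∈ Finset.range N, μ (t i)) :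
    m = incrementLaw μ := by
  classical
  refine Measure.eq_infinitePi _ fun s t ht => ?_
  have hs : s ⊆ Finset.range (s.sup id + 1) := fun i hi =>
    Finset.mem_range.mpr (Nat.lt_succ_of_le (Finset.le_sup (f := id) hi))
  have h := hm (s.sup id + 1) (fun i => if i ∈ s then t i else Set.univ)
    (fun i => by split_ifs; exacts [ht i, .univ])
  have e : Set.pi (Finset.range (s.sup id + 1)) (fun i => if i ∈ s then t i else Set.univ) =
      Set.pi s t := by
    ext x
    simp only [Set.mem_pi, Finset.mem_coe]
    constructor
    · intro hx i hi
      simpa [hi] using hx i (hs hi)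
    · intro hx i _
      split_ifs with hi
      exacts [hx i hi, Set.mem_univ _]
  rw [e] at h
  rw [h, ← Finset.prod_subset hs]
  · exact Finset.prod_congr rfl fun i hi => by simp [hi]
  · intro i _ hi
    simp [hi]

/-- The first increment is independent of the others, which have the same joint law as all of
them. -/
theorem map_prepend (μ : Measure G) [IsProbabilityMeasure μ] :
    (μ.prod (incrementLaw μ)).map (fun p => prepend p.1 p.2) = incrementLaw μ := by
  refine eq_incrementLaw fun N t ht => ?_
  rw [Measure.map_apply measurable_prepend
    (MeasurableSet.pi (Finset.countable_toSet _) fun i _ => ht i)]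
  cases N with
  | zero => simp
  | succ N =>
    have e : (fun p : G × (ℕ → G) => prepend p.1 p.2) ⁻¹' Set.pi (Finset.range (N + 1)) t =
        t 0 ×ˢ Set.pi (Finset.range N) fun i => t (i + 1) := by
      ext p
      exact prepend_mem_pi_range_succ p.1 p.2 N t
    rw [e, Measure.prod_prod, Measure.infinitePi_pi _ fun i _ => ht (i + 1),
      Finset.prod_range_succ', mul_comm]

theorem incrementLaw_apply (μ : Measure G) [IsProbabilityMeasure μ] {S : Set (ℕ → G)}
    (hS : MeasurableSet S) :
    incrementLaw μ S = ∫⁻ a, incrementLaw μ (prepend a ⁻¹' S) ∂μ := by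
  conv_lhs => rw [← map_prepend μ, Measure.map_apply measurable_prepend hS,
    Measure.prod_apply (measurable_prepend hS)]
  rfl

theorem isProb_real [MeasurableSingletonClass G] [Countable G]
    (μ : Measure G)
    [IsProbabilityMeasure μ] : IsProb fun g => μ.real {g} where
  nonneg _ := measureReal_nonneg
  hasSum := by
    have h1 : ∑' g, μ {g} = 1 := by
      rw [← μ.toPMF.tsum_coe]
      exact tsum_congr fun g => (μ.toPMF_apply g).symm
    have h2 := ENNReal.hasSum_toReal (f := fun g => μ {g}) (by rw [h1]; exact ENNReal.one_ne_top)
    rwa [← ENNReal.tsum_toReal_eq fun g => measure_ne_top μ {g}, h1, ENNReal.toReal_one] at h2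

theorem summable_negMulLog_of_entropy {μ : Measure G} [IsProbabilityMeasure μ]
    (hH : entropy μ ≠ ⊤) : Summable fun g => Real.negMulLog (μ.real {g}) := by
  refine (ENNReal.summable_toReal hH).congr fun g => ?_
  exact ENNReal.toReal_ofReal (Real.negMulLog_nonneg measureReal_nonneg measureReal_le_one)

theorem measurable_limsup_comp [DiscreteMeasurableSpace G] (f : G → ℝ) :
    Measurable fun x : ℕ → G => limsup (fun t => f (x t)) atTop :=
  Measurable.limsup fun t => (Measurable.of_discrete (f := f)).comp (measurable_pi_apply t)

theorem real_fst_singleton {H : Type*} [MeasurableSpace H]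
    [MeasurableSingletonClass G] [MeasurableSingletonClass H] [Countable G] [Countable H]
    (μ : Measure (G × H)) [IsProbabilityMeasure μ] :
    (fun a => μ.fst.real {a}) = marginalFst fun z => μ.real {z} := by
  funext a
  rw [Measure.real, Measure.fst_apply (MeasurableSet.singleton a),
    measure_preimage_fst_singleton_eq_tsum]
  exact ENNReal.tsum_toReal_eq fun _ => measure_ne_top _ _

theorem real_snd_singleton {H : Type*} [MeasurableSpace H]
    [MeasurableSingletonClass G] [MeasurableSingletonClass H] [Countable G] [Countable H]
    (μ : Measure (G × H)) [IsProbabilityMeasure μ] :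
    (fun a => μ.snd.real {a}) = marginalSnd fun z => μ.real {z} := by
  funext a
  rw [Measure.real, Measure.snd_apply (MeasurableSet.singleton a),
    measure_preimage_snd_singleton_eq_tsum]
  exact ENNReal.tsum_toReal_eq fun _ => measure_ne_top _ _

theorem map_restrict_eval_succ (μ : Measure G) [IsProbabilityMeasure μ] (n : ℕ) :
    (incrementLaw μ).map (fun h => (Preorder.frestrictLe (π := fun _ => G) n h, h (n + 1))) =
      ((incrementLaw μ).map (Preorder.frestrictLe n)).prod μ := by
  have hi : ProbabilityTheory.iIndepFun (fun (i : ℕ) (h : ℕ → G) => h i) (incrementLaw μ) :=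
    ProbabilityTheory.iIndepFun_infinitePi (P := fun _ : ℕ => μ) (X := fun _ x => x)
      fun _ => measurable_id
  have h1 := (hi.indepFun_finset (Finset.Iic n) {n + 1} (by simp)
    fun i => measurable_pi_apply i).comp measurable_id
      (measurable_pi_apply (⟨n + 1, Finset.mem_singleton_self _⟩ : ({n + 1} : Finset ℕ)))
  have h2 := (ProbabilityTheory.indepFun_iff_map_prod_eq_prod_map_map
    (Measurable.aemeasurable (by fun_prop)) (Measurable.aemeasurable (by fun_prop))).mp h1
  have h3 : (incrementLaw μ).map (fun h => h (n + 1)) = μ := Measure.infinitePi_map_eval _ (n + 1)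
  exact h2.trans (congrArg (Measure.prod _) h3)

end Increments

variable {G H : Type*} [Group G] [Group H]

/-! ### Sample paths and invariant events -/

theorem path_congr (g : G) {h h' : ℕ → G} {t : ℕ} (hh : ∀ i < t, h i = h' i) :
    path g h t = path g h' t := by
  induction t with
  | zero => rfl
  | succ t ih =>
    rw [path, path, ih fun i hi => hh i (hi.trans (Nat.lt_succ_self t)), hh t (Nat.lt_succ_self t)]

theorem path_map (φ : G →* H) (g : G) (h : ℕ → G) (t : ℕ) :
    path (φ g) (fun i => φ (h i)) t = φ (path g h t) := by
  induction t with
  | zero => rfl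
  | succ t ih => rw [path, path, ih, map_mul]

theorem shift_path_prepend (g a : G) (h : ℕ → G) :
    shift (path g (prepend a h)) = path (g * a) h := by
  funext t
  induction t with
  | zero => rfl
  | succ t ih =>
    rw [path, ← ih]
    rfl

theorem prepend_preimage_path {B : Set (ℕ → G)} (hinv : shift ⁻¹' B = B) (g a : G) :
    prepend a ⁻¹' (path g ⁻¹' B) = path (g * a) ⁻¹' B := by
  ext h
  simp only [Set.mem_preimage]
  rw [← shift_path_prepend]
  conv_lhs => rw [← hinv]
  rfl

variable [MeasurableSpace G] [MeasurableSpace H] [DiscreteMeasurableSpace G]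
  [DiscreteMeasurableSpace H] [Countable G] [Countable H]

theorem measurable_path_right (g : G) : Measurable (path g) :=
  measurable_path.comp measurable_prodMk_left

theorem markovMeasure_dirac_one_apply (μ : Measure G) [IsProbabilityMeasure μ] {B : Set (ℕ → G)}
    (hB : MeasurableSet B) :
    markovMeasure μ (Measure.dirac 1) B = incrementLaw μ (path 1 ⁻¹' B) := by
  rw [markovMeasure, Measure.dirac_prod, Measure.map_map measurable_path measurable_prodMk_left,
    Measure.map_apply (measurable_path.comp measurable_prodMk_left) hB]
  rfl

theorem markovMeasure_absolutelyContinuous (μ : Measure G) [IsProbabilityMeasure μ] :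
    markovMeasure μ (Measure.dirac 1) ≪ markovMeasure μ Measure.count := by
  refine Measure.AbsolutelyContinuous.map (Measure.AbsolutelyContinuous.prod ?_ .rfl)
    measurable_path
  refine Measure.AbsolutelyContinuous.mk fun s _ h0 => ?_
  rw [Measure.count_eq_zero_iff] at h0
  simp [h0]

/-- The completion in the exit σ-algebra is immaterial: the measure of the walk issued from the
identity is absolutely continuous with respect to the measure with counting initial distribution. -/
theorem isLiouville_iff_invariant (μ : Measure G) [IsProbabilityMeasure μ] :
    IsLiouville μ ↔ ∀ B : Set (ℕ → G), MeasurableSet B → shift ⁻¹' B = B →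
      incrementLaw μ (path 1 ⁻¹' B) = 0 ∨ incrementLaw μ (path 1 ⁻¹' B) = 1 := by
  constructor
  · intro h B hB hinv
    rw [← markovMeasure_dirac_one_apply μ hB]
    exact h B ⟨B, MeasurableSpace.measurableSet_invariants.mpr ⟨hB, hinv⟩, EventuallyEq.rfl⟩
  · rintro h A ⟨B, hB, hAB⟩
    obtain ⟨hB, hinv⟩ := MeasurableSpace.measurableSet_invariants.mp hB
    rw [measure_congr ((markovMeasure_absolutelyContinuous μ).ae_eq hAB),
      markovMeasure_dirac_one_apply μ hB]
    exact h B hB hinv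

theorem IsLiouville.map {μ : Measure G} [IsProbabilityMeasure μ] (h : IsLiouville μ)
    (φ : G →* H) : IsLiouville (μ.map φ) := by
  have hφ : Measurable φ := Measurable.of_discrete
  have := Measure.isProbabilityMeasure_map (μ := μ) hφ.aemeasurable
  rw [isLiouville_iff_invariant] at h ⊢
  intro B hB hinv
  have hΦ : Measurable fun (x : ℕ → G) (i : ℕ) => φ (x i) :=
    measurable_pi_iff.mpr fun i => hφ.comp (measurable_pi_apply i)
  have h1 := h ((fun x i => φ (x i)) ⁻¹' B) (hΦ hB) (by
    conv_rhs => rw [← hinv]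
    rfl)
  have h2 : incrementLaw (μ.map φ) = (incrementLaw μ).map fun x i => φ (x i) :=
    (Measure.infinitePi_map_pi (fun _ : ℕ => μ) fun _ => hφ).symm
  have h3 : (fun (x : ℕ → G) (i : ℕ) => φ (x i)) ⁻¹' (path 1 ⁻¹' B) =
      path 1 ⁻¹' ((fun x i => φ (x i)) ⁻¹' B) := by
    ext x
    have : path (1 : H) (fun i => φ (x i)) = fun i => φ (path 1 x i) := by
      funext t
      rw [← path_map, map_one]
    simp only [Set.mem_preimage, this]
  rw [h2, Measure.map_apply hΦ (measurable_path_right 1 hB), h3]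
  exact h1

theorem integral_eq_avg (μ : Measure G) [IsProbabilityMeasure μ] {f : G → ℝ} {C : ℝ}
    (hf : ∀ x, |f x| ≤ C) (x : G) :
    ∫ a, f (x * a) ∂μ = avg (fun g => μ.real {g}) f x := by
  rw [integral_countable]
  · rfl
  · exact Integrable.of_bound Measurable.of_discrete.aestronglyMeasurable C
      (ae_of_all _ fun a => hf _)

/-- If the probability of an invariant event does not change along the steps of the walk, then the
event is independent of the increments. -/
theorem incrementLaw_inter_pi {μ : Measure G} [IsProbabilityMeasure μ] {B : Set (ℕ → G)}
    (hB : MeasurableSet B) (hinv : shift ⁻¹' B = B)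
    (hc : ∀ g, ∀ᵐ a ∂μ, incrementLaw μ (path (g * a) ⁻¹' B) = incrementLaw μ (path g ⁻¹' B))
    (N : ℕ) (t : ℕ → Set G) (g : G) :
    incrementLaw μ (path g ⁻¹' B ∩ Set.pi (Finset.range N) t) =
      incrementLaw μ (path g ⁻¹' B) * ∏ i ∈ Finset.range N, μ (t i) := by
  induction N generalizing t g with
  | zero => simp
  | succ N ih =>
    have hm : MeasurableSet (path g ⁻¹' B ∩ Set.pi (Finset.range (N + 1)) t) :=
      (measurable_path_right g hB).inter
        (MeasurableSet.pi (Finset.countable_toSet _) fun i _ => .of_discrete)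
    rw [incrementLaw_apply μ hm]
    have e : ∀ a, prepend a ⁻¹' (path g ⁻¹' B ∩ Set.pi (Finset.range (N + 1)) t) =
        {h | a ∈ t 0} ∩ (path (g * a) ⁻¹' B ∩ Set.pi (Finset.range N) fun i => t (i + 1)) := by
      intro a
      rw [Set.preimage_inter, prepend_preimage_path hinv]
      ext h
      have := prepend_mem_pi_range_succ a h N t
      simp only [Set.mem_inter_iff, Set.mem_preimage, Set.mem_ofPred_eq, this]
      tauto
    have h1 : (fun a => incrementLaw μ
        (prepend a ⁻¹' (path g ⁻¹' B ∩ Set.pi (Finset.range (N + 1)) t))) =ᵐ[μ]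
        (t 0).indicator fun _ =>
          incrementLaw μ (path g ⁻¹' B) * ∏ i ∈ Finset.range N, μ (t (i + 1)) := by
      filter_upwards [hc g] with a ha
      rw [e a]
      by_cases h0 : a ∈ t 0
      · rw [Set.indicator_of_mem h0, ← ha, ← ih]
        simp [h0]
      · simp [h0]
    rw [lintegral_congr_ae h1, lintegral_indicator .of_discrete, setLIntegral_const,
      Finset.prod_range_succ', mul_assoc]

/-- If bounded harmonic functions are trivial, then invariant events are trivial. -/
theorem LiouvilleProperty.isLiouville {μ : Measure G} [IsProbabilityMeasure μ]
    (h : LiouvilleProperty fun g => μ.real {g}) : IsLiouville μ := by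
  rw [isLiouville_iff_invariant]
  intro B hB hinv
  set F : G → ℝ := fun g => (incrementLaw μ).real (path g ⁻¹' B) with hF
  have hF1 : ∀ g, |F g| ≤ 1 := fun g => by
    rw [abs_of_nonneg measureReal_nonneg]
    exact measureReal_le_one
  have hharm : ∀ g, avg (fun g => μ.real {g}) F g = F g := fun g => by
    rw [← integral_eq_avg μ hF1, hF]
    simp only [Measure.real]
    rw [integral_toReal Measurable.of_discrete.aemeasurable
      (ae_of_all _ fun a => measure_lt_top _ _), incrementLaw_apply μ (measurable_path_right g hB)]
    simp only [prepend_preimage_path hinv]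
  have hc : ∀ g, ∀ᵐ a ∂μ,
      incrementLaw μ (path (g * a) ⁻¹' B) = incrementLaw μ (path g ⁻¹' B) := by
    intro g
    rw [ae_iff_of_countable]
    intro a ha
    have h1 := h (fun x => F (g * x)) 1 (fun x => hF1 _)
      (fun x => by
        rw [← hharm (g * x)]
        simp only [avg, mul_assoc])
      a (by rwa [Ne, measureReal_eq_zero_iff])
    rw [mul_one] at h1
    exact (measureReal_eq_measureReal_iff).mp h1
  by_cases h0 : incrementLaw μ (path 1 ⁻¹' B) = 0
  · exact Or.inl h0
  right
  set c := incrementLaw μ (path 1 ⁻¹' B) with hcdef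
  have hct : c ≠ ⊤ := measure_ne_top _ _
  -- Conditioning on the event does not change the law, so the event has full measure.
  have h1 : c⁻¹ • (incrementLaw μ).restrict (path 1 ⁻¹' B) = incrementLaw μ := by
    refine eq_incrementLaw fun N t ht => ?_
    rw [Measure.smul_apply, Measure.restrict_apply
      (MeasurableSet.pi (Finset.countable_toSet _) fun i _ => ht i), Set.inter_comm,
      incrementLaw_inter_pi hB hinv hc, smul_eq_mul, ← mul_assoc, ENNReal.inv_mul_cancel h0 hct,
      one_mul]
  rw [hcdef, ← prob_compl_eq_zero_iff (measurable_path_right 1 hB), ← h1]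
  simp [measurable_path_right 1 hB]

/-! ### Harmonic functions along sample paths -/

theorem exists_path_eq_restrict (n : ℕ) : ∃ Φ : ((Finset.Iic n) → G) → G,
    Measurable Φ ∧ ∀ h : ℕ → G, path 1 h (n + 1) = Φ (Preorder.frestrictLe n h) := by
  let E : ((Finset.Iic n) → G) → ℕ → G := fun u i =>
    if hi : i ∈ Finset.Iic n then u ⟨i, hi⟩ else 1
  have hE : Measurable E := by
    refine measurable_pi_iff.mpr fun i => ?_
    by_cases hi : i ∈ Finset.Iic n
    · simp only [E, hi, dite_true]
      exact measurable_pi_apply _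
    · simp only [E, hi, dite_false]
      exact measurable_const
  refine ⟨fun u => path 1 (E u) (n + 1),
    (measurable_pi_apply (n + 1)).comp ((measurable_path_right 1).comp hE), fun h => ?_⟩
  refine path_congr 1 fun i hi => ?_
  have : i ∈ Finset.Iic n := Finset.mem_Iic.mpr (Nat.lt_succ_iff.mp hi)
  simp only [E, this, dite_true]
  rfl

/-- A bounded harmonic function along the walk is a martingale. The `n`-th σ-algebra of the
filtration `piLE` is generated by the increments `h 0, …, h n`, whence the index `n + 1` of the
path. -/
theorem martingale_harmonic {μ : Measure G} [IsProbabilityMeasure μ] {f : G → ℝ} {C : ℝ}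
    (hf : ∀ x, |f x| ≤ C) (hh : ∀ x, avg (fun g => μ.real {g}) f x = f x) :
    Martingale (fun (n : ℕ) (h : ℕ → G) => f (path 1 h (n + 1)))
      (Filtration.piLE (X := fun _ : ℕ => G)) (incrementLaw μ) := by
  have hfm : Measurable f := Measurable.of_discrete
  have hpm : ∀ n, Measurable fun h : ℕ → G => f (path 1 h n) := fun n =>
    hfm.comp ((measurable_pi_apply n).comp (measurable_path_right 1))
  refine martingale_of_setIntegral_eq_succ (fun n => ?_) (fun n => ?_) fun n s hs => ?_
  · obtain ⟨Φ, hΦ, hp⟩ := exists_path_eq_restrict (G := G) n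
    simp only [hp]
    rw [Filtration.piLE_eq_comap_frestrictLe]
    exact ((hfm.comp hΦ).comp (comap_measurable _)).stronglyMeasurable
  · exact Integrable.of_bound (hpm (n + 1)).aestronglyMeasurable C (ae_of_all _ fun h => hf _)
  · obtain ⟨Φ, hΦ, hp⟩ := exists_path_eq_restrict (G := G) n
    rw [Filtration.piLE_eq_comap_frestrictLe] at hs
    obtain ⟨S, hS, rfl⟩ := hs
    have hr : Measurable (Preorder.frestrictLe (π := fun _ : ℕ => G) n) := by fun_prop
    have hm := map_restrict_eval_succ μ n
    set ρ := (incrementLaw μ).map (Preorder.frestrictLe (π := fun _ : ℕ => G) n) with hρ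
    have : IsProbabilityMeasure ρ := Measure.isProbabilityMeasure_map hr.aemeasurable
    have hΨ : Measurable fun z : ((Finset.Iic n) → G) × G =>
        S.indicator (fun u => f (Φ u * z.2)) z.1 := by
      have h1 : Measurable fun z : ((Finset.Iic n) → G) × G => f (Φ z.1 * z.2) :=
        (Measurable.of_discrete (f := fun w : G × G => f (w.1 * w.2))).comp
          ((hΦ.comp measurable_fst).prodMk measurable_snd)
      exact h1.indicator (measurable_fst hS)
    have hb : ∀ z : ((Finset.Iic n) → G) × G,
        ‖S.indicator (fun u => f (Φ u * z.2)) z.1‖ ≤ C := fun z =>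
      (norm_indicator_le_norm_self _ _).trans (hf _)
    have hL : ∫ h in Preorder.frestrictLe (π := fun _ : ℕ => G) n ⁻¹' S, f (path 1 h (n + 1))
        ∂(incrementLaw μ) = ∫ u, S.indicator (fun u => f (Φ u)) u ∂ρ := by
      have h1 : Measurable (S.indicator fun u => f (Φ u)) := (hfm.comp hΦ).indicator hS
      rw [hρ, integral_map hr.aemeasurable h1.aestronglyMeasurable,
        ← integral_indicator (hr hS)]
      refine integral_congr_ae (ae_of_all _ fun h => ?_)
      simp only [hp, Set.indicator]
      rfl
    have hR : ∫ h in Preorder.frestrictLe (π := fun _ : ℕ => G) n ⁻¹' S, f (path 1 h (n + 1 + 1))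
        ∂(incrementLaw μ) = ∫ z, S.indicator (fun u => f (Φ u * z.2)) z.1 ∂(ρ.prod μ) := by
      rw [← hm, integral_map (hr.prodMk (measurable_pi_apply (n + 1))).aemeasurable
        hΨ.aestronglyMeasurable, ← integral_indicator (hr hS)]
      refine integral_congr_ae (ae_of_all _ fun h => ?_)
      simp only [path, ← hp, Set.indicator]
      rfl
    rw [hL, hR, integral_prod _ (Integrable.of_bound hΨ.aestronglyMeasurable C (ae_of_all _ hb))]
    refine integral_congr_ae (ae_of_all _ fun u => ?_)
    by_cases hu : u ∈ S
    · simp only [Set.indicator_of_mem hu]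
      rw [integral_eq_avg μ hf, hh]
    · simp [Set.indicator_of_notMem hu]

theorem IsLiouville.limsup_ae_const {μ : Measure G} [IsProbabilityMeasure μ] (h : IsLiouville μ)
    (f : G → ℝ) :
    ∃ c, (fun x : ℕ → G => limsup (fun t => f (path 1 x t)) atTop) =ᵐ[incrementLaw μ]
      fun _ => c := by
  rw [isLiouville_iff_invariant] at h
  refine exists_eventuallyEq_const_of_forall_separating MeasurableSet fun U hU => ?_
  have hB := measurable_limsup_comp f hU
  have hm := measurable_path_right (G := G) 1 hB
  rcases h _ hB (by
    ext x
    simp only [Set.mem_preimage, shift]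
    rw [Filter.limsup_nat_add (fun t => f (x t)) 1]) with h0 | h1
  · right
    rw [← compl_compl (path 1 ⁻¹' _), ← mem_ae_iff] at h0
    exact h0
  · left
    rw [← prob_compl_eq_zero_iff hm, ← mem_ae_iff] at h1
    exact h1

/-- If invariant events are trivial, then bounded harmonic functions are trivial. -/
theorem IsLiouville.liouvilleProperty {μ : Measure G} [IsProbabilityMeasure μ]
    (h : IsLiouville μ) : LiouvilleProperty fun g => μ.real {g} := by
  intro f C hf hh a ha
  have hM := martingale_harmonic hf hh
  obtain ⟨c, hc⟩ := h.limsup_ae_const f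
  have hfm : Measurable f := Measurable.of_discrete
  have hpm : ∀ n, Measurable fun h : ℕ → G => f (path 1 h n) := fun n =>
    hfm.comp ((measurable_pi_apply n).comp (measurable_path_right 1))
  have hlim : ∀ᵐ x ∂(incrementLaw μ), Tendsto (fun n => f (path 1 x (n + 1))) atTop (𝓝 c) := by
    have h1 := hM.submartingale.ae_tendsto_limitProcess (R := C.toNNReal) fun n => by
      refine (eLpNorm_le_of_ae_bound (ae_of_all _ fun x => hf _)).trans ?_
      simp [ENNReal.ofReal]
    filter_upwards [h1, hc] with x hx hcx
    have h2 := hx.limsup_eq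
    rw [Filter.limsup_nat_add (fun n => f (path 1 x n)) 1, hcx] at h2
    rwa [← h2] at hx
  -- The martingale starts at `f (x 0)` and tends to `c`, so both have the same integral over every
  -- event depending only on the first increment.
  have key : ∀ s, MeasurableSet[Filtration.piLE (X := fun _ : ℕ => G) 0] s →
      ∫ x in s, f (x 0) ∂(incrementLaw μ) = (incrementLaw μ).real s * c := by
    intro s hs
    have h1 : Tendsto (fun n => ∫ x in s, f (path 1 x (n + 1)) ∂(incrementLaw μ)) atTop
        (𝓝 (∫ x in s, c ∂(incrementLaw μ))) :=
      tendsto_integral_of_dominated_convergence (fun _ => C)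
        (fun n => (hpm (n + 1)).aestronglyMeasurable) (integrable_const C)
        (fun n => ae_of_all _ fun x => hf _) (ae_restrict_of_ae hlim)
    rw [setIntegral_const, smul_eq_mul] at h1
    have h2 : ∀ n, ∫ x in s, f (path 1 x (n + 1)) ∂(incrementLaw μ) =
        ∫ x in s, f (x 0) ∂(incrementLaw μ) := fun n => by
      rw [← hM.setIntegral_eq (Nat.zero_le n) hs]
      simp only [path, one_mul]
    simp only [h2] at h1
    exact tendsto_nhds_unique tendsto_const_nhds h1
  have hev : Measurable[Filtration.piLE (X := fun _ : ℕ => G) 0] fun x : ℕ → G => x 0 := by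
    rw [Filtration.piLE_eq_comap_frestrictLe]
    exact (measurable_pi_apply (X := fun _ : Finset.Iic 0 => G) ⟨0, by simp⟩).comp
      (comap_measurable _)
  have hmap : (incrementLaw μ).map (fun x => x 0) = μ := Measure.infinitePi_map_eval _ 0
  have hf1 : f 1 = c := by
    have h1 := key Set.univ MeasurableSet.univ
    rw [setIntegral_univ, probReal_univ, one_mul] at h1
    rw [← h1, ← hh 1, ← integral_eq_avg μ hf]
    simp only [one_mul]
    conv_lhs => rw [← hmap]
    exact integral_map (measurable_pi_apply 0).aemeasurable hfm.aestronglyMeasurable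
  have hfa : f a = c := by
    have h1 := key ((fun x => x 0) ⁻¹' {a}) (hev (MeasurableSet.singleton a))
    have hs : MeasurableSet ((fun x : ℕ → G => x 0) ⁻¹' {a}) :=
      measurable_pi_apply 0 (MeasurableSet.singleton a)
    rw [setIntegral_congr_fun (g := fun _ => f a) hs (fun x hx => by
      rw [show x 0 = a from hx]), setIntegral_const, smul_eq_mul] at h1
    have h2 : (incrementLaw μ).real ((fun x : ℕ → G => x 0) ⁻¹' {a}) = μ.real {a} := by
      conv_rhs => rw [← hmap]
      rw [map_measureReal_apply (measurable_pi_apply 0) (MeasurableSet.singleton a)]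
    rw [h2] at h1
    exact mul_left_cancel₀ ha h1
  rw [hfa, hf1]

end RandomWalk

end

theorem proposition2 {G G' : Type*} [Group G] [Countable G] [MeasurableSpace G]
    [DiscreteMeasurableSpace G] [Group G'] [Countable G'] [MeasurableSpace G']
    [DiscreteMeasurableSpace G'] (μ : MeasureTheory.Measure (G × G'))
    [MeasureTheory.IsProbabilityMeasure μ] (hH : RandomWalk.entropy μ ≠ ⊤) :
    RandomWalk.IsLiouville μ ↔
      RandomWalk.IsLiouville μ.fst ∧ RandomWalk.IsLiouville μ.snd := by
  constructor
  · exact fun h => ⟨h.map (MonoidHom.fst G G'), h.map (MonoidHom.snd G G')⟩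
  · rintro ⟨h1, h2⟩
    have h1' := h1.liouvilleProperty
    have h2' := h2.liouvilleProperty
    rw [RandomWalk.real_fst_singleton] at h1'
    rw [RandomWalk.real_snd_singleton] at h2'
    exact (RandomWalk.LiouvilleProperty.prod (RandomWalk.isProb_real μ)
      (RandomWalk.summable_negMulLog_of_entropy hH) h1' h2').isLiouville
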